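/- **Theorem 3.8 (Boundary Principle of a Single Big Jump decomposition).** Let $A$, $X$ and $B_1,B_2,\dots$ be random variables on a probability space $(\Omega,\mathcal F,\mathbb P)$ with values in $\mathbb Z_+=\{0,1,2,\dots\}$. Suppose that the $B_i$ are i.i.d. (write $B$ for a generic one), that $X$ is independent of $\{B_i\}_{i\ge1}$, that $A$ is independent of $(X,\{B_i\}_{i\ge1})$, and that $$X\stackrel{d}{=}A+\sum_{i=1}^{X}B_i .$$ Suppose moreover that $b:=\mathbb E B\in(0,1)$, that $\mathbb P(A>x)\sim(1+x)^{-1}$ as $x\to\infty$, and that $\mathbb P(B>x)=L(x)/(1+x)$ for all $x>0$, where $L:(0,\infty)\to(0,\infty)$ is measurable and slowly varying (i.e. $L(tx)/L(x)\to1$ as $x\to\infty$ for every $t>0$) and $L(x)\sim(\log x)^{-1-\varepsilon}$ as $x\to\infty$ for some $\varepsilon>0$. Define the laws of $D_n$, $n\ge1$, recursively by $$D_1\stackrel{d}{=}B,\qquad D_{n+1}\stackrel{d}{=}\sum_{i=1}^{B}D_{n,i},$$ where $\{D_{n,i}\}_{i\ge1}$ are i.i.d. copies of $D_n$, independent of $B$.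 For each $n\ge1$ let $A_{n+1}\stackrel{d}{=}A$ be independent of the i.i.d. copies $\{D_{n,i}\}_{i\ge1}$ of $D_n$. Then the series $\sum_{n\ge1}\mathbb P\bigl(\sum_{i=1}^{A_{n+1}}D_{n,i}>x\bigr)$ converges for every $x\ge0$; as $x\to\infty$, $$\mathbb P(X>x)\ \sim\ \mathbb P(A>x)+\sum_{n\ge1}\mathbb P\Bigl(\sum_{i=1}^{A_{n+1}}D_{n,i}>x\Bigr);$$ and for each fixed $n\ge1$, as $x\to\infty$, $$\mathbb P\Bigl(\sum_{i=1}^{A_{n+1}}D_{n,i}>x\Bigr)\ \sim\ \mathbb E\bigl[A\,\mathbf 1\{A\le x b^{-n}\}\bigr]\cdot n\,b^{\,n-1}\,\mathbb P(B>x)+\mathbb P(A>x b^{-n}).$$ -/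

import Mathlib

open MeasureTheory ProbabilityTheory Filter Asymptotics

/-- A measurable `L : (0,∞) → (0,∞)` is slowly varying if `L (t x) / L x → 1` as `x → ∞` for each
`t > 0`. The values of `L` outside `(0,∞)` play no role. -/
structure IsSlowlyVarying (L : ℝ → ℝ) : Prop where
  measurable : Measurable (fun x : Set.Ioi (0 : ℝ) => L x)
  pos : ∀ x, 0 < x → 0 < L x
  tendsto : ∀ t, 0 < t → Tendsto (fun x => L (t * x) / L x) atTop (nhds 1)

/-- The law of `Y₁ + ⋯ + Y_k` for i.i.d. `Yᵢ` with law `μ`: the `k`-fold convolution power. -/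
noncomputable def iidSumLaw (μ : Measure ℕ) : ℕ → Measure ℕ
  | 0 => Measure.dirac 0
  | k + 1 => (iidSumLaw μ k).conv μ

/-- The law of the random sum `Y₁ + ⋯ + Y_N`, where `N` has law `ν`, the `Yᵢ` are i.i.d. with
law `μ`, and `N` is independent of `(Yᵢ)`; see `map_randomSum`. -/
noncomputable def randomSumLaw (ν μ : Measure ℕ) : Measure ℕ :=
  ν.bind (iidSumLaw μ)

/-- The law of the branching aggregate `D_n`, `n ≥ 1`, for the offspring law `β` (the law of `B`):
`D_1` has law `β`, and `D_{n+1}` is distributed as `D_{n,1} + ⋯ + D_{n,B}` with i.i.d. copies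
`D_{n,i}` of `D_n` independent of `B`. (Index `0` is a convention and is not used.) -/
noncomputable def aggregateLaw (β : Measure ℕ) : ℕ → Measure ℕ
  | 0 => Measure.dirac 1
  | 1 => β
  | n + 2 => randomSumLaw β (aggregateLaw β (n + 1))

/-- `P (∑_{i=1}^{A_{n+1}} D_{n,i} > x)`, where `A_{n+1}` has law `α` and is independent of the
i.i.d. copies `D_{n,i}` of the aggregate `D_n` with offspring law `β`. -/
noncomputable def clusterTail (α β : Measure ℕ) (n : ℕ) (x : ℝ) : ℝ :=
  (randomSumLaw α (aggregateLaw β n)).real {k : ℕ | x < (k : ℝ)}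

theorem map_iidSum {Ω : Type*} [MeasurableSpace Ω] {P : Measure Ω} [IsProbabilityMeasure P]
    {Y : ℕ → Ω → ℕ} {μ : Measure ℕ} (hY : ∀ i, Measurable (Y i)) (hind : iIndepFun Y P)
    (hlaw : ∀ i, P.map (Y i) = μ) (k : ℕ) :
    P.map (fun ω => ∑ i ∈ Finset.range k, Y i ω) = iidSumLaw μ k := by
  induction k with
  | zero => simp [iidSumLaw]
  | succ k ih =>
    have h : IndepFun (fun ω => ∑ i ∈ Finset.range k, Y i ω) (Y k) P := by
      have := hind.indepFun_finsetSum_of_notMem (s := Finset.range k) (i := k) hY (by simp)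
      convert this using 1
      ext ω; simp
    have hm : Measurable (fun ω => ∑ i ∈ Finset.range k, Y i ω) :=
      Finset.measurable_sum _ fun i _ => hY i
    have := h.map_add_eq_map_conv_map hm (hY k)
    rw [ih, hlaw k] at this
    rw [iidSumLaw, ← this]
    congr 1
    ext ω; simp [Finset.sum_range_succ]

/-- `randomSumLaw` is the law of a random sum of random variables. -/
theorem map_randomSum {Ω : Type*} [MeasurableSpace Ω] {P : Measure Ω} [IsProbabilityMeasure P]
    {N : Ω → ℕ} {Y : ℕ → Ω → ℕ} {μ : Measure ℕ} (hN : Measurable N) (hY : ∀ i, Measurable (Y i))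
    (hind : iIndepFun Y P) (hlaw : ∀ i, P.map (Y i) = μ)
    (hNY : IndepFun N (fun ω i => Y i ω) P) :
    P.map (fun ω => ∑ i ∈ Finset.range (N ω), Y i ω) = randomSumLaw (P.map N) μ := by
  have hS : ∀ k, Measurable (fun ω => ∑ i ∈ Finset.range k, Y i ω) := fun k =>
    Finset.measurable_sum _ fun i _ => hY i
  have hm : Measurable (fun ω => ∑ i ∈ Finset.range (N ω), Y i ω) := by
    have h2 : Measurable (fun p : Ω × ℕ => ∑ i ∈ Finset.range p.2, Y i p.1) :=
      measurable_from_prod_countable_left fun k => hS k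
    exact h2.comp (measurable_id.prodMk hN)
  ext s hs
  rw [Measure.map_apply hm hs, randomSumLaw, Measure.bind_apply hs (by fun_prop),
    lintegral_countable']
  have hU : (fun ω => ∑ i ∈ Finset.range (N ω), Y i ω) ⁻¹' s =
      ⋃ k, (N ⁻¹' {k} ∩ (fun ω => ∑ i ∈ Finset.range k, Y i ω) ⁻¹' s) := by
    ext ω; simp
  rw [hU, measure_iUnion]
  · refine tsum_congr fun k => ?_
    have hk : IndepFun N (fun ω => ∑ i ∈ Finset.range k, Y i ω) P :=
      hNY.comp (φ := id) (ψ := fun y : ℕ → ℕ => ∑ i ∈ Finset.range k, y i) measurable_id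
        (Finset.measurable_sum _ fun i _ => measurable_pi_apply i)
    rw [hk.measure_inter_preimage_eq_mul _ _ (measurableSet_singleton k) hs,
      Measure.map_apply hN (measurableSet_singleton k), ← map_iidSum hY hind hlaw k,
      Measure.map_apply (hS k) hs, mul_comm]
  · intro i j hij
    refine Set.disjoint_left.mpr fun ω h1 h2 => hij ?_
    rw [← h1.1, ← h2.1]
  · intro k
    exact (hN (measurableSet_singleton k)).inter (hS k hs)

/-! Every asymptotic relation is proved by showing that both sides, multiplied by `x`, tend to the
same nonzero constant: `b ^ n` for the `n`-th term and `(1 - b)⁻¹` for the tail of `X` and for the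
series together with the tail of `A`.

The boundary case works because two logarithms compete. Since `x P(A > x) → 1`, the truncated mean
of `A` is only `O(log x)`. The assumption on `L` gives `x log x P(B > x) → 0`, so the truncated
second moment `V(x)` of `B` is `o(x / log x)`. Take a random sum of copies of `B` whose number `N`
of terms has truncated mean `O(log x)`. If `N ≤ θ x` with `θ b < 1`, truncation and Chebyshev bound
the probability that the sum exceeds `x` by a constant times `N V(x) / x²`. Averaging over `N`
leaves `O(log x) V(x) / x² = o(1/x)`. Hence a large sum essentially requires `N > θ x`. Conversely,
the law of large numbers makes the sum exceed `x` with high probability once `N > θ x` and `θ b >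
1`. One branching step therefore multiplies the limit of `x` times the tail by `b`
(`tailProb_randomSumLaw_error`, `tendsto_mul_tailProb_randomSumLaw`).

Associativity of random sums identifies the `n`-th cluster with generation `n` of a branching
process started from `A`, so its scaled tail tends to `b ^ n`. A bound `K (n + 1) r ^ n` with `b < r
< 1`, uniform in `x ≥ 1` (`exists_generationLaw_bounds`), lets these limits be summed by dominated
convergence. For `X`, the same one-step estimates turn the fixed-point equation into inequalities
between the tail at `y` and at `y / t` with `t` near `b`. Iterating them gives `(1 - b)⁻¹` directly,
without representing `X` as a series or using uniqueness of the solution. -/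

/-! ### Truncated moments and the algebra of random sums. -/

/-- The tail `μ (x, ∞)` of a law on `ℕ`. -/
noncomputable def tailProb (μ : Measure ℕ) (x : ℝ) : ℝ := μ.real {k : ℕ | x < (k : ℝ)}

/-- The truncated mean `∫ min k x dμ(k)` of a law on `ℕ`. -/
noncomputable def truncMean (μ : Measure ℕ) (x : ℝ) : ℝ := ∫ k, min (k : ℝ) x ∂μ

/-- The truncated second moment `∫ (min k x)² dμ(k)` of a law on `ℕ`. -/
noncomputable def truncSq (μ : Measure ℕ) (x : ℝ) : ℝ := ∫ k, (min (k : ℝ) x) ^ 2 ∂μ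

instance isProbabilityMeasure_iidSumLaw (μ : Measure ℕ) [IsProbabilityMeasure μ] (k : ℕ) :
    IsProbabilityMeasure (iidSumLaw μ k) := by
  induction k with
  | zero => rw [iidSumLaw]; infer_instance
  | succ k ih => rw [iidSumLaw]; infer_instance

theorem measurable_iidSumLaw (μ : Measure ℕ) : Measurable (iidSumLaw μ) := by fun_prop

instance isProbabilityMeasure_randomSumLaw (ν μ : Measure ℕ) [IsProbabilityMeasure ν]
    [IsProbabilityMeasure μ] : IsProbabilityMeasure (randomSumLaw ν μ) := by
  constructor
  rw [randomSumLaw, Measure.bind_apply MeasurableSet.univ (measurable_iidSumLaw μ).aemeasurable]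
  simp

theorem iidSumLaw_add (μ : Measure ℕ) [IsProbabilityMeasure μ] (j k : ℕ) :
    iidSumLaw μ (j + k) = (iidSumLaw μ j).conv (iidSumLaw μ k) := by
  induction k with
  | zero => simp [iidSumLaw]
  | succ k ih => rw [← add_assoc, iidSumLaw, ih, Measure.conv_assoc, iidSumLaw]

theorem iidSumLaw_one (μ : Measure ℕ) [IsProbabilityMeasure μ] : iidSumLaw μ 1 = μ := by
  simp [iidSumLaw]

theorem randomSumLaw_dirac_one_right (ν : Measure ℕ) :
    randomSumLaw ν (Measure.dirac 1) = ν := by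
  have h : iidSumLaw (Measure.dirac 1) = fun k => Measure.dirac k := by
    funext k
    induction k with
    | zero => rfl
    | succ k ih => rw [iidSumLaw, ih, Measure.dirac_conv_dirac]
  rw [randomSumLaw, h]
  exact Measure.bind_dirac

theorem randomSumLaw_dirac (μ : Measure ℕ) (k : ℕ) :
    randomSumLaw (Measure.dirac k) μ = iidSumLaw μ k :=
  Measure.dirac_bind (measurable_iidSumLaw μ) k

/-- The branching property: two independent groups of individuals have independent total offspring.
-/
theorem randomSumLaw_conv (ν₁ ν₂ μ : Measure ℕ) [IsProbabilityMeasure ν₁]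
    [IsProbabilityMeasure ν₂] [IsProbabilityMeasure μ] :
    randomSumLaw (ν₁.conv ν₂) μ = (randomSumLaw ν₁ μ).conv (randomSumLaw ν₂ μ) := by
  have hm : ∀ ν : Measure ℕ, AEMeasurable (iidSumLaw μ) ν := fun ν =>
    (measurable_iidSumLaw μ).aemeasurable
  refine Measure.ext_of_lintegral _ fun f hf => ?_
  rw [randomSumLaw, Measure.lintegral_bind (hm _) hf.aemeasurable,
    Measure.lintegral_conv measurable_from_top, Measure.lintegral_conv hf, randomSumLaw,
    Measure.lintegral_bind (hm _) measurable_from_top.aemeasurable]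
  refine lintegral_congr fun j => ?_
  have h1 : ∀ k, ∫⁻ x, f x ∂(iidSumLaw μ (j + k)) =
      ∫⁻ x, ∫⁻ y, f (x + y) ∂(iidSumLaw μ k) ∂(iidSumLaw μ j) := by
    intro k
    rw [iidSumLaw_add, Measure.lintegral_conv hf]
  simp_rw [h1]
  rw [lintegral_lintegral_swap Measurable.of_discrete.aemeasurable]
  refine lintegral_congr fun x => ?_
  rw [randomSumLaw, Measure.lintegral_bind (hm _) measurable_from_top.aemeasurable]

theorem randomSumLaw_iidSumLaw (ν μ : Measure ℕ) [IsProbabilityMeasure ν]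
    [IsProbabilityMeasure μ] (k : ℕ) :
    randomSumLaw (iidSumLaw ν k) μ = iidSumLaw (randomSumLaw ν μ) k := by
  induction k with
  | zero => rw [iidSumLaw, randomSumLaw_dirac, iidSumLaw, iidSumLaw]
  | succ k ih => rw [iidSumLaw, randomSumLaw_conv, ih, iidSumLaw]

/-- Grouping descendants by ancestor or by parent gives the same total. -/
theorem randomSumLaw_assoc (α ν μ : Measure ℕ) [IsProbabilityMeasure ν]
    [IsProbabilityMeasure μ] :
    randomSumLaw (randomSumLaw α ν) μ = randomSumLaw α (randomSumLaw ν μ) := by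
  rw [randomSumLaw, randomSumLaw, Measure.bind_bind (measurable_iidSumLaw ν).aemeasurable
    (measurable_iidSumLaw μ).aemeasurable, randomSumLaw]
  congr 1
  funext k
  exact randomSumLaw_iidSumLaw ν μ k

instance isProbabilityMeasure_aggregateLaw (β : Measure ℕ) [IsProbabilityMeasure β] (n : ℕ) :
    IsProbabilityMeasure (aggregateLaw β n) := by
  induction n with
  | zero => rw [aggregateLaw]; infer_instance
  | succ n ih =>
    cases n with
    | zero => rw [aggregateLaw]; infer_instance
    | succ n => rw [aggregateLaw]; infer_instance

/-- The definition branches at the root. Branching at the leaves instead puts the fixed offspring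
law `β` in the summand slot, so a single one-step estimate serves every generation. -/
theorem aggregateLaw_succ (β : Measure ℕ) [IsProbabilityMeasure β] (n : ℕ) :
    aggregateLaw β (n + 1) = randomSumLaw (aggregateLaw β n) β := by
  induction n with
  | zero => rw [aggregateLaw, aggregateLaw, randomSumLaw_dirac, iidSumLaw_one]
  | succ n ih =>
    cases n with
    | zero => simp only [aggregateLaw]
    | succ n => rw [aggregateLaw, ih, ← randomSumLaw_assoc, ← aggregateLaw, ih]

/-- The law of the `n`-th generation of the branching process with offspring law `β` started
from an `α`-distributed number of individuals. -/
noncomputable def generationLaw (α β : Measure ℕ) : ℕ → Measure ℕ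
  | 0 => α
  | n + 1 => randomSumLaw (generationLaw α β n) β

instance isProbabilityMeasure_generationLaw (α β : Measure ℕ) [IsProbabilityMeasure α]
    [IsProbabilityMeasure β] (n : ℕ) : IsProbabilityMeasure (generationLaw α β n) := by
  induction n with
  | zero => rw [generationLaw]; infer_instance
  | succ n ih => rw [generationLaw]; infer_instance

theorem clusterTail_eq_tailProb (α β : Measure ℕ) [IsProbabilityMeasure β] (n : ℕ) (x : ℝ) :
    clusterTail α β n x = tailProb (generationLaw α β n) x := by
  have h : randomSumLaw α (aggregateLaw β n) = generationLaw α β n := by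
    induction n with
    | zero => rw [aggregateLaw, randomSumLaw_dirac_one_right, generationLaw]
    | succ n ih => rw [aggregateLaw_succ, ← randomSumLaw_assoc, ih, generationLaw]
  rw [clusterTail, h, tailProb]

/-! ### Elementary bounds for tails and truncated moments. -/

theorem integrable_nat_of_norm_le {μ : Measure ℕ} [IsFiniteMeasure μ] {f : ℕ → ℝ} (C : ℝ)
    (h : ∀ k, |f k| ≤ C) : Integrable f μ :=
  Integrable.of_bound measurable_from_top.aestronglyMeasurable C (ae_of_all _ h)

theorem abs_min_natCast_le {x : ℝ} (hx : 0 ≤ x) (k : ℕ) : |min (k : ℝ) x| ≤ x := by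
  rw [abs_of_nonneg (le_min k.cast_nonneg hx)]
  exact min_le_right _ _

theorem integrable_min_natCast (μ : Measure ℕ) [IsFiniteMeasure μ] {x : ℝ} (hx : 0 ≤ x) :
    Integrable (fun k : ℕ => min (k : ℝ) x) μ :=
  integrable_nat_of_norm_le x (abs_min_natCast_le hx)

theorem integrable_min_natCast_sq (μ : Measure ℕ) [IsFiniteMeasure μ] {x : ℝ} (hx : 0 ≤ x) :
    Integrable (fun k : ℕ => (min (k : ℝ) x) ^ 2) μ :=
  integrable_nat_of_norm_le (x ^ 2) fun k => by
    rw [abs_pow]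
    exact pow_le_pow_left₀ (abs_nonneg _) (abs_min_natCast_le hx k) 2

theorem tailProb_nonneg (μ : Measure ℕ) (x : ℝ) : 0 ≤ tailProb μ x := measureReal_nonneg

theorem tailProb_le_one (μ : Measure ℕ) [IsProbabilityMeasure μ] (x : ℝ) : tailProb μ x ≤ 1 :=
  measureReal_le_one

theorem tailProb_anti (μ : Measure ℕ) [IsProbabilityMeasure μ] : Antitone (tailProb μ) :=
  fun _ _ hxy => measureReal_mono fun _ hk => lt_of_le_of_lt hxy hk

theorem truncMean_nonneg (μ : Measure ℕ) {x : ℝ} (hx : 0 ≤ x) : 0 ≤ truncMean μ x :=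
  integral_nonneg fun k => le_min k.cast_nonneg hx

theorem truncSq_nonneg (μ : Measure ℕ) (x : ℝ) : 0 ≤ truncSq μ x :=
  integral_nonneg fun _ => sq_nonneg _

theorem truncMean_mono (μ : Measure ℕ) [IsProbabilityMeasure μ] {x y : ℝ} (hx : 0 ≤ x)
    (hxy : x ≤ y) : truncMean μ x ≤ truncMean μ y :=
  integral_mono (integrable_min_natCast μ hx) (integrable_min_natCast μ (hx.trans hxy))
    fun _ => min_le_min_left _ hxy

theorem truncSq_mono (μ : Measure ℕ) [IsProbabilityMeasure μ] {x y : ℝ} (hx : 0 ≤ x)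
    (hxy : x ≤ y) : truncSq μ x ≤ truncSq μ y :=
  integral_mono (integrable_min_natCast_sq μ hx) (integrable_min_natCast_sq μ (hx.trans hxy))
    fun k => pow_le_pow_left₀ (le_min k.cast_nonneg hx) (min_le_min_left _ hxy) 2

theorem tailProb_eq_integral (μ : Measure ℕ) (x : ℝ) :
    tailProb μ x = ∫ k : ℕ, (if x < (k : ℝ) then 1 else 0) ∂μ := by
  have h : (fun k : ℕ => if x < (k : ℝ) then (1 : ℝ) else 0) =
      Set.indicator {k : ℕ | x < (k : ℝ)} 1 := by
    funext k; simp [Set.indicator_apply]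
  rw [h, integral_indicator_one (Set.to_countable _).measurableSet, tailProb]

theorem integrable_tailIndicator (μ : Measure ℕ) [IsFiniteMeasure μ] (x : ℝ) :
    Integrable (fun k : ℕ => if x < (k : ℝ) then (1 : ℝ) else 0) μ :=
  integrable_nat_of_norm_le 1 fun k => by split_ifs <;> simp

theorem tailProb_mul_le_truncMean (μ : Measure ℕ) [IsProbabilityMeasure μ] {x : ℝ} (hx : 0 ≤ x) :
    x * tailProb μ x ≤ truncMean μ x := by
  rw [tailProb_eq_integral, ← integral_const_mul]
  refine integral_mono ((integrable_tailIndicator μ x).const_mul x) (integrable_min_natCast μ hx)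
    fun k => ?_
  dsimp only
  split_ifs with h
  · rw [min_eq_right h.le, mul_one]
  · rw [mul_zero]; exact le_min k.cast_nonneg hx

theorem tailProb_le_truncSq_div (μ : Measure ℕ) [IsProbabilityMeasure μ] {x : ℝ} (hx : 0 < x) :
    tailProb μ x ≤ truncSq μ x / x ^ 2 := by
  rw [le_div_iff₀ (by positivity), mul_comm, tailProb_eq_integral, ← integral_const_mul]
  refine integral_mono ((integrable_tailIndicator μ x).const_mul _)
    (integrable_min_natCast_sq μ hx.le) fun k => ?_
  dsimp only
  split_ifs with h
  · rw [min_eq_right h.le, mul_one]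
  · rw [mul_zero]; positivity

theorem tailProb_map {Ω : Type*} [MeasurableSpace Ω] {P : Measure Ω} {Y : Ω → ℕ}
    (hY : Measurable Y) (x : ℝ) : tailProb (P.map Y) x = P.real {ω | x < (Y ω : ℝ)} := by
  rw [tailProb, map_measureReal_apply hY (Set.to_countable _).measurableSet]
  rfl

theorem tailProb_randomSumLaw (ν μ : Measure ℕ) [IsProbabilityMeasure μ] (x : ℝ) :
    tailProb (randomSumLaw ν μ) x = ∫ k, tailProb (iidSumLaw μ k) x ∂ν := by
  rw [tailProb, measureReal_def, randomSumLaw, Measure.bind_apply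
    (Set.to_countable _).measurableSet (measurable_iidSumLaw μ).aemeasurable, ← integral_toReal
    measurable_from_top.aemeasurable (ae_of_all _ fun k => measure_lt_top _ _)]
  rfl

theorem truncMean_randomSumLaw (ν μ : Measure ℕ) [IsProbabilityMeasure ν]
    [IsProbabilityMeasure μ] {x : ℝ} (hx : 0 ≤ x) :
    truncMean (randomSumLaw ν μ) x = ∫ k, truncMean (iidSumLaw μ k) x ∂ν := by
  have h0 : ∀ k : ℕ, 0 ≤ min (k : ℝ) x := fun k => le_min k.cast_nonneg hx
  have h1 : ∀ m : Measure ℕ, truncMean m x = (∫⁻ k, ENNReal.ofReal (min (k : ℝ) x) ∂m).toReal :=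
    fun m => integral_eq_lintegral_of_nonneg_ae (ae_of_all _ h0)
      measurable_from_top.aestronglyMeasurable
  have h2 : ∀ k, (∫⁻ j, ENNReal.ofReal (min (j : ℝ) x) ∂(iidSumLaw μ k)) < ⊤ := fun k =>
    (hasFiniteIntegral_iff_ofReal (ae_of_all _ h0)).1 (integrable_min_natCast _ hx).2
  rw [h1, randomSumLaw, Measure.lintegral_bind (measurable_iidSumLaw μ).aemeasurable
    measurable_from_top.aemeasurable, ← integral_toReal measurable_from_top.aemeasurable
    (ae_of_all _ h2)]
  exact integral_congr_ae (ae_of_all _ fun k => (h1 _).symm)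

theorem identDistrib_natCast {Ω : Type*} [MeasurableSpace Ω] {P : Measure Ω} {B : ℕ → Ω → ℕ}
    (hid : ∀ i, IdentDistrib (B i) (B 0) P P) (i : ℕ) :
    IdentDistrib (fun ω => (B i ω : ℝ)) (fun ω => (B 0 ω : ℝ)) P P :=
  (hid i).comp (u := fun k : ℕ => (k : ℝ)) measurable_from_top

/-! ### One branching step. -/

section IID

variable {Ω : Type*} [MeasurableSpace Ω] {P : Measure Ω} [IsProbabilityMeasure P]
  {B : ℕ → Ω → ℕ}

theorem map_sum_range_eq_iidSumLaw (hm : ∀ i, Measurable (B i)) (hind : iIndepFun B P)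
    (hid : ∀ i, IdentDistrib (B i) (B 0) P P) (k : ℕ) :
    P.map (fun ω => ∑ i ∈ Finset.range k, B i ω) = iidSumLaw (P.map (B 0)) k :=
  map_iidSum hm hind (fun i => (hid i).map_eq) k

theorem truncMean_iidSumLaw_le (hm : ∀ i, Measurable (B i)) (hind : iIndepFun B P)
    (hid : ∀ i, IdentDistrib (B i) (B 0) P P) (hint : Integrable (fun ω => (B 0 ω : ℝ)) P)
    (k : ℕ) {x : ℝ} (hx : 0 ≤ x) :
    truncMean (iidSumLaw (P.map (B 0)) k) x ≤ k * ∫ ω, (B 0 ω : ℝ) ∂P := by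
  have hmS : Measurable (fun ω => ∑ i ∈ Finset.range k, B i ω) :=
    Finset.measurable_sum _ fun i _ => hm i
  have hi : ∀ i, Integrable (fun ω => (B i ω : ℝ)) P := fun i =>
    (identDistrib_natCast hid i).integrable_iff.2 hint
  have hS : Integrable (fun ω => ∑ i ∈ Finset.range k, (B i ω : ℝ)) P :=
    integrable_finsetSum _ fun i _ => hi i
  rw [truncMean, ← map_sum_range_eq_iidSumLaw hm hind hid k,
    integral_map hmS.aemeasurable measurable_from_top.aestronglyMeasurable]
  calc ∫ ω, min ((∑ i ∈ Finset.range k, B i ω : ℕ) : ℝ) x ∂P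
      ≤ ∫ ω, ∑ i ∈ Finset.range k, (B i ω : ℝ) ∂P := by
        refine integral_mono_of_nonneg (ae_of_all _ fun ω => le_min (Nat.cast_nonneg _) hx) hS
          (ae_of_all _ fun ω => ?_)
        dsimp only
        rw [← Nat.cast_sum]
        exact min_le_left _ _
    _ = k * ∫ ω, (B 0 ω : ℝ) ∂P := by
        rw [integral_finsetSum _ fun i _ => hi i, Finset.sum_congr rfl fun i _ =>
          (identDistrib_natCast hid i).integral_eq]
        simp

/-- Truncate each summand at `x`. Either some summand exceeds `x`, which costs `k V / x ^ 2` by a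
union bound, or the truncated sum deviates from its mean by at least `δ x`, which costs `k V / (δ x)
^ 2` by Chebyshev. -/
theorem tailProb_iidSumLaw_le (hm : ∀ i, Measurable (B i)) (hind : iIndepFun B P)
    (hid : ∀ i, IdentDistrib (B i) (B 0) P P) (hint : Integrable (fun ω => (B 0 ω : ℝ)) P)
    {k : ℕ} {x δ : ℝ} (hx : 0 < x) (hδ : 0 < δ)
    (hk : k * ∫ ω, (B 0 ω : ℝ) ∂P ≤ (1 - δ) * x) :
    tailProb (iidSumLaw (P.map (B 0)) k) x ≤
      (1 + 1 / δ ^ 2) * (k * (truncSq (P.map (B 0)) x / x ^ 2)) := by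
  have : IsProbabilityMeasure (P.map (B 0)) :=
    Measure.isProbabilityMeasure_map (hm 0).aemeasurable
  have hmS : Measurable (fun ω => ∑ i ∈ Finset.range k, B i ω) :=
    Finset.measurable_sum _ fun i _ => hm i
  set V := truncSq (P.map (B 0)) x with hV
  let Y : ℕ → Ω → ℝ := fun i ω => min (B i ω : ℝ) x
  have hYm : ∀ i, Measurable (Y i) := fun i =>
    (measurable_from_top (f := fun k : ℕ => min (k : ℝ) x)).comp (hm i)
  have hY0 : ∀ i ω, 0 ≤ Y i ω := fun i ω => le_min (Nat.cast_nonneg _) hx.le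
  have hYL : ∀ i, MemLp (Y i) 2 P := fun i =>
    MemLp.of_bound (hYm i).aestronglyMeasurable x (ae_of_all _ fun ω => abs_min_natCast_le hx.le _)
  have hYint : ∀ i, Integrable (Y i) P := fun i => (hYL i).integrable one_le_two
  have hYmean : ∀ i, ∫ ω, Y i ω ∂P ≤ ∫ ω, (B 0 ω : ℝ) ∂P := fun i => by
    rw [← (identDistrib_natCast hid i).integral_eq]
    exact integral_mono (hYint i) ((identDistrib_natCast hid i).integrable_iff.2 hint)
      fun ω => min_le_left _ _
  have hYvar : ∀ i, variance (Y i) P ≤ V := fun i => by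
    refine (variance_le_expectation_sq (hYm i).aestronglyMeasurable).trans_eq ?_
    rw [hV, truncSq, ← (hid i).map_eq, integral_map (hm i).aemeasurable
      measurable_from_top.aestronglyMeasurable]
    rfl
  have hYind : iIndepFun Y P :=
    hind.comp (fun _ (k : ℕ) => min (k : ℝ) x) fun _ => measurable_from_top
  have hSL : MemLp (∑ i ∈ Finset.range k, Y i) 2 P := memLp_finsetSum' _ fun i _ => hYL i
  have hSvar : variance (∑ i ∈ Finset.range k, Y i) P ≤ k * V := by
    rw [IndepFun.variance_sum (fun i _ => hYL i) fun i _ j _ hij => hYind.indepFun hij]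
    refine (Finset.sum_le_sum fun i _ => hYvar i).trans_eq ?_
    simp
  have hSmean : ∫ ω, (∑ i ∈ Finset.range k, Y i) ω ∂P ≤ (1 - δ) * x := by
    refine le_trans ?_ hk
    simp_rw [Finset.sum_apply]
    rw [integral_finsetSum _ fun i _ => hYint i]
    refine (Finset.sum_le_sum fun i _ => hYmean i).trans_eq ?_
    simp
  rw [← map_sum_range_eq_iidSumLaw hm hind hid k, tailProb_map hmS]
  have hsub : {ω | x < ((∑ i ∈ Finset.range k, B i ω : ℕ) : ℝ)} ⊆
      (⋃ i ∈ Finset.range k, {ω | x < (B i ω : ℝ)}) ∪ {ω | δ * x ≤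
        |(∑ i ∈ Finset.range k, Y i) ω - ∫ ω, (∑ i ∈ Finset.range k, Y i) ω ∂P|} := by
    intro ω hω
    -- Without a summand above `x`, truncation changes nothing, and the mean is at most `(1 - δ) *
    -- x`.
    by_cases h : ∃ i ∈ Finset.range k, x < (B i ω : ℝ)
    · exact Or.inl (by simpa using h)
    · right
      push Not at h
      have h1 : (∑ i ∈ Finset.range k, Y i) ω = ((∑ i ∈ Finset.range k, B i ω : ℕ) : ℝ) := by
        rw [Finset.sum_apply, Nat.cast_sum]
        exact Finset.sum_congr rfl fun i hi => min_eq_left (h i hi)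
      have h2 : x < ((∑ i ∈ Finset.range k, B i ω : ℕ) : ℝ) := hω
      change δ * x ≤ |_|
      rw [h1]
      exact le_trans (by linarith) (le_abs_self _)
  have h1 : P.real (⋃ i ∈ Finset.range k, {ω | x < (B i ω : ℝ)}) ≤ k * (V / x ^ 2) := by
    refine (measureReal_biUnion_finset_le _ _).trans ?_
    have : ∀ i ∈ Finset.range k, P.real {ω | x < (B i ω : ℝ)} ≤ V / x ^ 2 := fun i _ => by
      rw [← tailProb_map (hm i), (hid i).map_eq]
      exact tailProb_le_truncSq_div _ hx
    refine (Finset.sum_le_sum this).trans_eq ?_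
    simp
  have h2 : P.real {ω | δ * x ≤
      |(∑ i ∈ Finset.range k, Y i) ω - ∫ ω, (∑ i ∈ Finset.range k, Y i) ω ∂P|} ≤
      k * V / (δ * x) ^ 2 := by
    have h := meas_ge_le_variance_div_sq hSL (mul_pos hδ hx)
    refine (ENNReal.toReal_mono ENNReal.ofReal_ne_top h).trans ?_
    rw [ENNReal.toReal_ofReal (div_nonneg (variance_nonneg _ _) (sq_nonneg _))]
    gcongr
  refine (measureReal_mono hsub).trans ((measureReal_union_le _ _).trans
    ((add_le_add h1 h2).trans_eq ?_))
  field_simp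

/-- Only a first moment is assumed here, so the law of large numbers is used. Convergence in
probability controls the tail of the `k`-fold sum at `k / θ`, and monotonicity makes the bound
uniform over all `k > θ x`. -/
theorem eventually_le_tailProb_iidSumLaw (hm : ∀ i, Measurable (B i)) (hind : iIndepFun B P)
    (hid : ∀ i, IdentDistrib (B i) (B 0) P P) (hint : Integrable (fun ω => (B 0 ω : ℝ)) P)
    {θ η : ℝ} (hθ0 : 0 < θ) (hθ : 1 < θ * ∫ ω, (B 0 ω : ℝ) ∂P) (hη : 0 < η) :
    ∀ᶠ x : ℝ in atTop, ∀ k : ℕ, θ * x < k →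
      1 - η ≤ tailProb (iidSumLaw (P.map (B 0)) k) x := by
  set b := ∫ ω, (B 0 ω : ℝ) ∂P with hb
  have hmS : ∀ k, Measurable (fun ω => ∑ i ∈ Finset.range k, B i ω) := fun k =>
    Finset.measurable_sum _ fun i _ => hm i
  have hmR : ∀ k, Measurable (fun ω => (∑ i ∈ Finset.range k, (B i ω : ℝ)) / k) := fun k =>
    (Finset.measurable_sum _ fun i _ => measurable_from_top.comp (hm i)).div_const _
  have hlln := strong_law_ae_real (fun i ω => (B i ω : ℝ)) hint
    (fun i j hij => (hind.indepFun hij).comp (φ := fun k : ℕ => (k : ℝ))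
      (ψ := fun k : ℕ => (k : ℝ)) measurable_from_top measurable_from_top)
    (identDistrib_natCast hid)
  have hmeas := tendstoInMeasure_of_tendsto_ae (fun k => (hmR k).aestronglyMeasurable) hlln
  rw [tendstoInMeasure_iff_norm] at hmeas
  have hgap : 0 < b - 1 / θ := by
    rw [sub_pos, div_lt_iff₀ hθ0]; linarith
  have h1 := hmeas (b - 1 / θ) hgap
  have h2 : ∀ᶠ k : ℕ in atTop, 1 - η ≤ tailProb (iidSumLaw (P.map (B 0)) k) (k / θ) := by
    have h3 := (ENNReal.tendsto_nhds_zero.1 h1) (ENNReal.ofReal η) (by simpa using hη)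
    filter_upwards [h3, eventually_gt_atTop 0] with k hk hk0
    have hkR : (0 : ℝ) < k := by exact_mod_cast hk0
    rw [← map_sum_range_eq_iidSumLaw hm hind hid, tailProb_map (hmS k)]
    have h4 : P.real {ω | b - 1 / θ ≤ ‖(∑ i ∈ Finset.range k, (B i ω : ℝ)) / k - b‖} ≤ η := by
      have := ENNReal.toReal_mono ENNReal.ofReal_ne_top hk
      rwa [ENNReal.toReal_ofReal hη.le] at this
    have h5 : {ω | (k : ℝ) / θ < ((∑ i ∈ Finset.range k, B i ω : ℕ) : ℝ)}ᶜ ⊆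
        {ω | b - 1 / θ ≤ ‖(∑ i ∈ Finset.range k, (B i ω : ℝ)) / k - b‖} := by
      intro ω hω
      simp only [Set.mem_compl_iff, Set.mem_ofPred_eq, not_lt, Nat.cast_sum] at hω ⊢
      have h6 : (∑ i ∈ Finset.range k, (B i ω : ℝ)) / k ≤ 1 / θ := by
        rw [div_le_iff₀ hkR]
        calc _ ≤ _ := hω
          _ = _ := by ring
      rw [Real.norm_eq_abs, abs_sub_comm]
      exact le_trans (by linarith) (le_abs_self _)
    have h7 := (measureReal_mono (μ := P) h5).trans h4
    rw [probReal_compl_eq_one_sub] at h7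
    · linarith
    · exact (measurable_from_top.comp (hmS k) : Measurable fun ω =>
        ((∑ i ∈ Finset.range k, B i ω : ℕ) : ℝ)) measurableSet_Ioi
  obtain ⟨K, hK⟩ := eventually_atTop.1 h2
  filter_upwards [eventually_ge_atTop (K / θ : ℝ)] with x hx k hk
  have hKx : (K : ℝ) ≤ θ * x := by rwa [div_le_iff₀' hθ0] at hx
  have hKk : K ≤ k := by exact_mod_cast (hKx.trans hk.le)
  have : IsProbabilityMeasure (P.map (B 0)) :=
    Measure.isProbabilityMeasure_map (hm 0).aemeasurable
  refine (hK k hKk).trans (tailProb_anti _ ?_)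
  rw [le_div_iff₀ hθ0]; linarith

/-- One step of the branching: upper bound for the tail. -/
theorem tailProb_randomSumLaw_le (hm : ∀ i, Measurable (B i)) (hind : iIndepFun B P)
    (hid : ∀ i, IdentDistrib (B i) (B 0) P P) (hint : Integrable (fun ω => (B 0 ω : ℝ)) P)
    {θ : ℝ} (hθ0 : 0 < θ) (hθ : θ * ∫ ω, (B 0 ω : ℝ) ∂P < 1) :
    ∃ C, 0 ≤ C ∧ ∀ (ν : Measure ℕ) [IsProbabilityMeasure ν] (x : ℝ), 0 < x →
      tailProb (randomSumLaw ν (P.map (B 0))) x ≤ tailProb ν (θ * x) +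
        C * (truncMean ν (θ * x) * (truncSq (P.map (B 0)) x / x ^ 2)) := by
  set b := ∫ ω, (B 0 ω : ℝ) ∂P with hb
  have hb0 : 0 ≤ b := integral_nonneg fun ω => Nat.cast_nonneg _
  have : IsProbabilityMeasure (P.map (B 0)) :=
    Measure.isProbabilityMeasure_map (hm 0).aemeasurable
  have hδ : 0 < 1 - θ * b := by linarith
  refine ⟨1 + 1 / (1 - θ * b) ^ 2, by positivity, fun ν _ x hx => ?_⟩
  set C := 1 + 1 / (1 - θ * b) ^ 2
  set V := truncSq (P.map (B 0)) x / x ^ 2 with hV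
  have hV0 : 0 ≤ V := div_nonneg (truncSq_nonneg _ _) (sq_nonneg _)
  have hC0 : 0 ≤ C := by positivity
  have hθx : 0 ≤ θ * x := by positivity
  have hi := (integrable_min_natCast ν hθx).mul_const V |>.const_mul C
  rw [tailProb_randomSumLaw, tailProb_eq_integral, truncMean, ← integral_mul_const,
    ← integral_const_mul, ← integral_add (integrable_tailIndicator _ _) hi]
  refine integral_mono (integrable_nat_of_norm_le 1 fun k => ?_)
    ((integrable_tailIndicator _ _).add hi) fun k => ?_
  · rw [abs_of_nonneg (tailProb_nonneg _ _)]
    exact tailProb_le_one _ _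
  · dsimp only
    split_ifs with h
    · have : 0 ≤ C * (min (k : ℝ) (θ * x) * V) :=
        mul_nonneg hC0 (mul_nonneg (le_min k.cast_nonneg hθx) hV0)
      linarith [tailProb_le_one (iidSumLaw (P.map (B 0)) k) x]
    · push Not at h
      rw [min_eq_left h, zero_add]
      refine tailProb_iidSumLaw_le hm hind hid hint hx hδ ?_
      calc k * b ≤ θ * x * b := by gcongr
        _ = _ := by ring

/-- One step of the branching: lower bound for the tail. -/
theorem eventually_le_tailProb_randomSumLaw (hm : ∀ i, Measurable (B i)) (hind : iIndepFun B P)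
    (hid : ∀ i, IdentDistrib (B i) (B 0) P P) (hint : Integrable (fun ω => (B 0 ω : ℝ)) P)
    {θ η : ℝ} (hθ0 : 0 < θ) (hθ : 1 < θ * ∫ ω, (B 0 ω : ℝ) ∂P) (hη : 0 < η)
    (ν : Measure ℕ) [IsProbabilityMeasure ν] :
    ∀ᶠ x : ℝ in atTop,
      (1 - η) * tailProb ν (θ * x) ≤ tailProb (randomSumLaw ν (P.map (B 0))) x := by
  have : IsProbabilityMeasure (P.map (B 0)) :=
    Measure.isProbabilityMeasure_map (hm 0).aemeasurable
  filter_upwards [eventually_le_tailProb_iidSumLaw hm hind hid hint hθ0 hθ hη] with x hx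
  rw [tailProb_randomSumLaw, tailProb_eq_integral, ← integral_const_mul]
  refine integral_mono ((integrable_tailIndicator _ _).const_mul _)
    (integrable_nat_of_norm_le 1 fun k => ?_) fun k => ?_
  · rw [abs_of_nonneg (tailProb_nonneg _ _)]
    exact tailProb_le_one _ _
  · dsimp only
    split_ifs with h
    · rw [mul_one]; exact hx k h
    · rw [mul_zero]; exact tailProb_nonneg _ _

/-- Given `k` terms, the truncated mean is at most `min (k b) x = b min k (x / b)`. A step thus
gains a factor `b` and only dilates the truncation level, which is cheap under logarithmic growth.
-/
theorem truncMean_randomSumLaw_le (hm : ∀ i, Measurable (B i)) (hind : iIndepFun B P)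
    (hid : ∀ i, IdentDistrib (B i) (B 0) P P) (hint : Integrable (fun ω => (B 0 ω : ℝ)) P)
    {b : ℝ} (hb : b = ∫ ω, (B 0 ω : ℝ) ∂P) (hb0 : 0 < b)
    (ν : Measure ℕ) [IsProbabilityMeasure ν] {x : ℝ} (hx : 0 ≤ x) :
    truncMean (randomSumLaw ν (P.map (B 0))) x ≤ b * truncMean ν (x / b) := by
  have : IsProbabilityMeasure (P.map (B 0)) :=
    Measure.isProbabilityMeasure_map (hm 0).aemeasurable
  have hxb : 0 ≤ x / b := by positivity
  have hle : ∀ k, truncMean (iidSumLaw (P.map (B 0)) k) x ≤ x := fun k => by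
    refine (integral_mono (integrable_min_natCast _ hx) (integrable_const x)
      fun k => min_le_right _ _).trans_eq ?_
    simp
  rw [truncMean_randomSumLaw _ _ hx, truncMean, ← integral_const_mul]
  refine integral_mono (integrable_nat_of_norm_le x fun k => ?_)
    ((integrable_min_natCast ν hxb).const_mul b) fun k => ?_
  · rw [abs_of_nonneg (truncMean_nonneg _ hx)]
    exact hle k
  · dsimp only
    rw [mul_min_of_nonneg _ _ hb0.le, mul_div_cancel₀ _ hb0.ne']
    refine le_min ?_ (hle k)
    rw [mul_comm, hb]
    exact truncMean_iidSumLaw_le hm hind hid hint k hx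

end IID

/-! ### Truncated moments as tail sums, and their logarithmic growth. -/

theorem natCast_min_eq_sum (k N : ℕ) :
    min (k : ℝ) N = ∑ j ∈ Finset.range N, if (j : ℝ) < k then (1 : ℝ) else 0 := by
  induction N with
  | zero => simp
  | succ N ih =>
    rw [Finset.sum_range_succ, ← ih]
    rcases lt_or_ge N k with h | h
    · have h1 : (N : ℝ) < k := by exact_mod_cast h
      have h2 : ((N + 1 : ℕ) : ℝ) ≤ k := by exact_mod_cast h
      rw [if_pos h1, min_eq_right h2, min_eq_right h1.le]
      push_cast; ring
    · have h1 : (k : ℝ) ≤ N := by exact_mod_cast h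
      rw [if_neg (not_lt.2 h1), min_eq_left h1, min_eq_left (h1.trans (by push_cast; linarith)),
        add_zero]

theorem natCast_min_sq_eq_sum (k N : ℕ) :
    (min (k : ℝ) N) ^ 2 = ∑ j ∈ Finset.range N, (2 * (j : ℝ) + 1) *
      if (j : ℝ) < k then (1 : ℝ) else 0 := by
  induction N with
  | zero => simp
  | succ N ih =>
    rw [Finset.sum_range_succ, ← ih]
    rcases lt_or_ge N k with h | h
    · have h1 : (N : ℝ) < k := by exact_mod_cast h
      have h2 : ((N + 1 : ℕ) : ℝ) ≤ k := by exact_mod_cast h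
      rw [if_pos h1, min_eq_right h2, min_eq_right h1.le]
      push_cast; ring
    · have h1 : (k : ℝ) ≤ N := by exact_mod_cast h
      rw [if_neg (not_lt.2 h1), min_eq_left h1, min_eq_left (h1.trans (by push_cast; linarith)),
        mul_zero, add_zero]

theorem truncMean_natCast (μ : Measure ℕ) [IsFiniteMeasure μ] (N : ℕ) :
    truncMean μ N = ∑ j ∈ Finset.range N, tailProb μ j := by
  simp_rw [truncMean, natCast_min_eq_sum, tailProb_eq_integral]
  exact integral_finsetSum _ fun j _ => integrable_tailIndicator μ j

theorem truncSq_natCast (μ : Measure ℕ) [IsFiniteMeasure μ] (N : ℕ) :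
    truncSq μ N = ∑ j ∈ Finset.range N, (2 * (j : ℝ) + 1) * tailProb μ j := by
  simp_rw [truncSq, natCast_min_sq_eq_sum, tailProb_eq_integral, ← integral_const_mul]
  exact integral_finsetSum _ fun j _ => (integrable_tailIndicator μ j).const_mul _

theorem tendsto_tailProb_atTop (μ : Measure ℕ) [IsFiniteMeasure μ] :
    Tendsto (tailProb μ) atTop (nhds 0) := by
  have h : Tendsto (fun x : ℝ => ∫ k : ℕ, (if x < (k : ℝ) then (1 : ℝ) else 0) ∂μ) atTop
      (nhds (∫ _, (0 : ℝ) ∂μ)) := by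
    refine tendsto_integral_filter_of_dominated_convergence (fun _ => 1)
      (Eventually.of_forall fun x => measurable_from_top.aestronglyMeasurable)
      (Eventually.of_forall fun x => ae_of_all _ fun k => ?_) (integrable_const _)
      (ae_of_all _ fun k => ?_)
    · split_ifs <;> simp
    · refine tendsto_const_nhds.congr' ?_
      filter_upwards [eventually_ge_atTop (k : ℝ)] with x hx
      rw [if_neg (not_lt.2 hx)]
  simp_rw [← tailProb_eq_integral, integral_zero] at h
  exact h

theorem truncMean_le_log {μ : Measure ℕ} [IsProbabilityMeasure μ] {C : ℝ}
    (hμ : ∀ x, 0 ≤ x → tailProb μ x ≤ C / (1 + x)) {x : ℝ} (hx : 0 ≤ x) :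
    truncMean μ x ≤ C * (1 + Real.log (1 + x)) := by
  have hC : 0 ≤ C := by
    have := (tailProb_nonneg μ 0).trans (hμ 0 le_rfl)
    simpa using this
  refine (truncMean_mono μ hx (Nat.le_ceil x)).trans ?_
  rw [truncMean_natCast]
  have h1 : ∑ j ∈ Finset.range ⌈x⌉₊, tailProb μ j ≤ C * (harmonic ⌈x⌉₊ : ℝ) := by
    rw [harmonic]
    push_cast
    rw [Finset.mul_sum]
    refine Finset.sum_le_sum fun j _ => (hμ j j.cast_nonneg).trans_eq ?_
    rw [div_eq_mul_inv, add_comm]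
  refine h1.trans (mul_le_mul_of_nonneg_left ((harmonic_le_one_add_log _).trans ?_) hC)
  rcases eq_or_lt_of_le hx with h0 | h0
  · simp [← h0]
  · gcongr
    linarith [Nat.ceil_lt_add_one hx]

/-- A discrete comparison with `∫ dt / log t`: once `log N ≥ 4`, the increment of `N / log N` is at
least `1 / (2 log N)`. -/
theorem sum_range_le_of_le_div_log {a : ℕ → ℝ} {c : ℝ} (hc : 0 ≤ c) {J : ℕ}
    (hJ : ∀ j, J ≤ j → 4 ≤ Real.log j ∧ a j ≤ c / Real.log j) {N : ℕ} (hN : J ≤ N) :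
    ∑ j ∈ Finset.range N, a j ≤ ∑ j ∈ Finset.range J, a j + 2 * c * (N / Real.log N) := by
  induction N, hN using Nat.le_induction with
  | base =>
    have := (hJ J le_rfl).1
    have : 0 ≤ 2 * c * ((J : ℝ) / Real.log J) := by positivity
    linarith
  | succ N hN ih =>
    obtain ⟨h4, ha⟩ := hJ N hN
    have hN0 : (0 : ℝ) < N := by
      rcases Nat.eq_zero_or_pos N with h | h
      · rw [h] at h4; norm_num at h4
      · exact_mod_cast h
    have h4' : 4 ≤ Real.log ((N + 1 : ℕ) : ℝ) := (hJ (N + 1) (by omega)).1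
    have hlog : Real.log ((N + 1 : ℕ) : ℝ) ≤ Real.log N + 1 / N := by
      have h : ((N + 1 : ℕ) : ℝ) = N * (1 + 1 / N) := by push_cast; field_simp
      have h' : (0 : ℝ) < 1 + 1 / N := by positivity
      rw [h, Real.log_mul hN0.ne' h'.ne']
      linarith [Real.log_le_sub_one_of_pos h']
    set l := Real.log N
    set m := Real.log ((N + 1 : ℕ) : ℝ)
    have hN1 : (1 : ℝ) ≤ N := by exact_mod_cast (Nat.pos_of_ne_zero fun h => by simp [h] at hN0)
    have key : 1 / l ≤ 2 * (((N + 1 : ℕ) : ℝ) / m - N / l) := by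
      have hl0 : 0 < l := by linarith
      have hm0 : 0 < m := by linarith
      have h5 : N * m ≤ N * l + 1 := by
        have := mul_le_mul_of_nonneg_left hlog hN0.le
        rwa [mul_add, mul_one_div_cancel hN0.ne'] at this
      have h6 : m ≤ l + 1 := by
        refine hlog.trans ?_
        gcongr
        rw [div_le_one hN0]; exact hN1
      have : ((N + 1 : ℕ) : ℝ) / m - N / l = ((N + 1) * l - N * m) / (m * l) := by
        push_cast; field_simp
      rw [this, ← mul_div_assoc, div_le_div_iff₀ hl0 (by positivity)]
      have : m ≤ 2 * ((N + 1) * l - N * m) := by nlinarith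
      nlinarith
    rw [Finset.sum_range_succ]
    have h7 : a N ≤ c * (2 * (((N + 1 : ℕ) : ℝ) / m - N / l)) :=
      ha.trans (by rw [div_eq_mul_one_div]; exact mul_le_mul_of_nonneg_left key hc)
    linarith

theorem tendsto_log_div_natCast : Tendsto (fun N : ℕ => Real.log N / N) atTop (nhds 0) :=
  (Real.isLittleO_log_id_atTop.tendsto_div_nhds_zero).comp tendsto_natCast_atTop_atTop

/-- A Cesàro argument: terms of size `o(1 / log j)` have partial sums `o(N / log N)`, the initial
segment being negligible because `log N / N → 0`. -/
theorem tendsto_sum_mul_log_div {a : ℕ → ℝ} (ha0 : ∀ j, 0 ≤ a j)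
    (ha : Tendsto (fun j : ℕ => a j * Real.log j) atTop (nhds 0)) :
    Tendsto (fun N : ℕ => (∑ j ∈ Finset.range N, a j) * Real.log N / N) atTop (nhds 0) := by
  have hlog : Tendsto (fun N : ℕ => Real.log N) atTop atTop :=
    Real.tendsto_log_atTop.comp tendsto_natCast_atTop_atTop
  rw [tendsto_order]
  refine ⟨fun c hc => Eventually.of_forall fun N => hc.trans_le ?_, fun c hc => ?_⟩
  · exact div_nonneg (mul_nonneg (Finset.sum_nonneg fun j _ => ha0 j)
      (Real.log_natCast_nonneg N)) N.cast_nonneg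
  · have hc3 : 0 < c / 3 := by positivity
    obtain ⟨J, hJ⟩ := eventually_atTop.1
      ((hlog.eventually_ge_atTop 4).and (ha.eventually_le_const hc3))
    have hJ' : ∀ j, J ≤ j → 4 ≤ Real.log j ∧ a j ≤ c / 3 / Real.log j := fun j hj => by
      obtain ⟨h1, h2⟩ := hJ j hj
      exact ⟨h1, (le_div_iff₀ (by linarith)).2 h2⟩
    have hM := (tendsto_log_div_natCast.const_mul (∑ j ∈ Finset.range J, a j)).eventually_lt_const
      (show (∑ j ∈ Finset.range J, a j) * 0 < c / 3 by simpa using hc3)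
    filter_upwards [hM, eventually_ge_atTop J, eventually_gt_atTop 0] with N h1 h2 h3
    have h4 := (hJ' N h2).1
    have hN0 : (0 : ℝ) < N := by exact_mod_cast h3
    have h5 := sum_range_le_of_le_div_log hc3.le hJ' h2
    have hl0 : 0 < Real.log N := by linarith
    calc (∑ j ∈ Finset.range N, a j) * Real.log N / N
        ≤ (∑ j ∈ Finset.range J, a j + 2 * (c / 3) * (N / Real.log N)) * Real.log N / N := by
          gcongr
      _ = (∑ j ∈ Finset.range J, a j) * (Real.log N / N) + 2 * (c / 3) := by
          field_simp
      _ < c := by linarith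

/-- At integers, `truncSq` is the sum of `(2 j + 1)` times the tail at `j`, and the hypothesis makes
these terms `o(1 / log j)`. -/
theorem tendsto_truncSq_mul_log_div {μ : Measure ℕ} [IsProbabilityMeasure μ]
    (hμ : Tendsto (fun x : ℝ => tailProb μ x * x * Real.log x) atTop (nhds 0)) :
    Tendsto (fun x : ℝ => truncSq μ x * Real.log x / x) atTop (nhds 0) := by
  have ha : Tendsto (fun j : ℕ => (2 * (j : ℝ) + 1) * tailProb μ j * Real.log j) atTop
      (nhds 0) := by
    have h := (hμ.comp tendsto_natCast_atTop_atTop).const_mul 3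
    rw [mul_zero] at h
    refine squeeze_zero' (Eventually.of_forall fun j => ?_) ?_ h
    · have := tailProb_nonneg μ j
      have := Real.log_natCast_nonneg j
      positivity
    · filter_upwards [eventually_ge_atTop 1] with j hj
      have hj' : (1 : ℝ) ≤ j := by exact_mod_cast hj
      calc (2 * (j : ℝ) + 1) * tailProb μ j * Real.log j
          ≤ (3 * j) * tailProb μ j * Real.log j := by
            have := tailProb_nonneg μ j
            have := Real.log_natCast_nonneg j
            gcongr
            linarith
        _ = _ := by simp only [Function.comp]; ring
  have hN := tendsto_sum_mul_log_div
    (fun j => mul_nonneg (by positivity) (tailProb_nonneg μ j)) ha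
  simp_rw [← truncSq_natCast] at hN
  -- The factor `2` pays for `⌈x⌉₊ ≤ 2 x` when passing from integers to real `x ≥ 1`.
  have h := (hN.comp (tendsto_nat_ceil_atTop (α := ℝ))).const_mul 2
  rw [mul_zero] at h
  refine squeeze_zero' ?_ ?_ h
  · filter_upwards [eventually_ge_atTop 1] with x hx
    exact div_nonneg (mul_nonneg (truncSq_nonneg _ _) (Real.log_nonneg hx)) (by linarith)
  · filter_upwards [eventually_ge_atTop 1] with x hx
    have hx0 : 0 < x := by linarith
    have h1 : x ≤ ⌈x⌉₊ := Nat.le_ceil x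
    have h2 : (⌈x⌉₊ : ℝ) ≤ 2 * x := by linarith [Nat.ceil_lt_add_one hx0.le]
    have h3 : 0 < (⌈x⌉₊ : ℝ) := hx0.trans_le h1
    have h4 : truncSq μ x * Real.log x ≤ truncSq μ ⌈x⌉₊ * Real.log ⌈x⌉₊ :=
      mul_le_mul (truncSq_mono μ hx0.le h1) (Real.log_le_log hx0 h1) (Real.log_nonneg hx)
        (truncSq_nonneg _ _)
    have h5 : 0 ≤ truncSq μ x * Real.log x :=
      mul_nonneg (truncSq_nonneg _ _) (Real.log_nonneg hx)
    simp only [Function.comp]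
    rw [← mul_div_assoc, div_le_div_iff₀ hx0 h3]
    nlinarith

/-- A logarithmic bound on truncated means survives against `truncSq`. -/
theorem tendsto_mul_log_mul_truncSq {μ : Measure ℕ} [IsProbabilityMeasure μ]
    (hμ : Tendsto (fun x : ℝ => tailProb μ x * x * Real.log x) atTop (nhds 0)) {θ : ℝ}
    (hθ : 0 < θ) :
    Tendsto (fun x : ℝ => x * ((1 + Real.log (1 + θ * x)) * (truncSq μ x / x ^ 2))) atTop
      (nhds 0) := by
  have h := (tendsto_truncSq_mul_log_div hμ).const_mul 3
  rw [mul_zero] at h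
  refine squeeze_zero' ?_ ?_ h
  · filter_upwards [eventually_ge_atTop 0] with x hx
    have := truncSq_nonneg μ x
    have : 0 ≤ Real.log (1 + θ * x) := Real.log_nonneg (by nlinarith)
    positivity
  · filter_upwards [eventually_ge_atTop 1, Real.tendsto_log_atTop.eventually_ge_atTop 1,
      Real.tendsto_log_atTop.eventually_ge_atTop (Real.log (1 + θ))] with x hx h1 h2
    have hx0 : 0 < x := by linarith
    have h3 : Real.log (1 + θ * x) ≤ Real.log (1 + θ) + Real.log x := by
      rw [← Real.log_mul (by positivity) hx0.ne']
      exact Real.log_le_log (by positivity) (by nlinarith)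
    have h4 := truncSq_nonneg μ x
    calc x * ((1 + Real.log (1 + θ * x)) * (truncSq μ x / x ^ 2))
        = (1 + Real.log (1 + θ * x)) * (truncSq μ x / x) := by field_simp
      _ ≤ (3 * Real.log x) * (truncSq μ x / x) := by
          gcongr
          linarith
      _ = _ := by ring

/-- The uniform companion of the preceding limit, needed to dominate all generations at once. -/
theorem exists_mul_log_mul_truncSq_le {μ : Measure ℕ} [IsProbabilityMeasure μ]
    (hμ : Tendsto (fun x : ℝ => tailProb μ x * x * Real.log x) atTop (nhds 0)) {θ : ℝ}
    (hθ : 0 < θ) :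
    ∃ C, 0 ≤ C ∧ ∀ x : ℝ, 1 ≤ x →
      x * ((1 + Real.log (1 + θ * x)) * (truncSq μ x / x ^ 2)) ≤ C := by
  obtain ⟨X₀, hX₀⟩ := eventually_atTop.1
    ((tendsto_mul_log_mul_truncSq hμ hθ).eventually_le_const one_pos)
  set Y := max X₀ 1
  have hY1 : 1 ≤ Y := le_max_right _ _
  have hlY : 0 ≤ Real.log (1 + θ * Y) := Real.log_nonneg (by nlinarith)
  have hC : 0 ≤ Y * ((1 + Real.log (1 + θ * Y)) * 1) := by positivity
  refine ⟨1 + Y * ((1 + Real.log (1 + θ * Y)) * 1), by positivity, fun x hx => ?_⟩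
  rcases le_total Y x with h | h
  · linarith [hX₀ x ((le_max_left _ _).trans h)]
  · have hx0 : 0 < x := by linarith
    have hV : truncSq μ x / x ^ 2 ≤ 1 := by
      rw [div_le_one (by positivity)]
      refine (integral_mono (integrable_min_natCast_sq μ hx0.le) (integrable_const (x ^ 2))
        fun k => pow_le_pow_left₀ (le_min k.cast_nonneg hx0.le) (min_le_right _ _) 2).trans_eq ?_
      simp
    have hV0 : 0 ≤ truncSq μ x / x ^ 2 := div_nonneg (truncSq_nonneg _ _) (sq_nonneg _)
    have : x * ((1 + Real.log (1 + θ * x)) * (truncSq μ x / x ^ 2)) ≤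
        Y * ((1 + Real.log (1 + θ * Y)) * 1) := by
      have : 0 ≤ Real.log (1 + θ * x) := Real.log_nonneg (by nlinarith)
      gcongr
    linarith

theorem exists_tailProb_le_div {μ : Measure ℕ} [IsProbabilityMeasure μ]
    (hμ : Tendsto (fun x : ℝ => x * tailProb μ x) atTop (nhds 1)) :
    ∃ C, 0 ≤ C ∧ ∀ x, 0 ≤ x → tailProb μ x ≤ C / (1 + x) := by
  obtain ⟨X₀, hX₀⟩ := eventually_atTop.1 (hμ.eventually_le_const one_lt_two)
  set Y := max X₀ 1
  have hY1 : 1 ≤ Y := le_max_right _ _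
  refine ⟨4 + (1 + Y), by positivity, fun x hx => ?_⟩
  rw [le_div_iff₀ (by positivity)]
  rcases le_total Y x with h | h
  · have h1 := hX₀ x ((le_max_left _ _).trans h)
    have h2 := tailProb_le_one μ x
    nlinarith
  · calc tailProb μ x * (1 + x) ≤ 1 * (1 + Y) := by
          gcongr
          exact tailProb_le_one μ x
      _ ≤ _ := by linarith

theorem log_one_add_div_pow_le {b : ℝ} (hb0 : 0 < b) (hb1 : b < 1) (n : ℕ) {x : ℝ} (hx : 0 ≤ x) :
    1 + Real.log (1 + x / b ^ n) ≤ (1 + n * Real.log b⁻¹) * (1 + Real.log (1 + x)) := by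
  have h1 : b ^ n ≤ 1 := pow_le_one₀ hb0.le hb1.le
  have h2 : 0 < b ^ n := by positivity
  have h3 : Real.log (1 + x / b ^ n) ≤ n * Real.log b⁻¹ + Real.log (1 + x) := by
    rw [← Real.log_pow, ← Real.log_mul (by positivity) (by positivity), inv_pow]
    refine Real.log_le_log (by positivity) ?_
    rw [mul_add, mul_one, inv_mul_eq_div]
    gcongr
    exact (one_le_inv₀ h2).2 h1
  have h4 : 0 ≤ Real.log b⁻¹ := Real.log_nonneg ((one_le_inv₀ hb0).2 hb1.le)
  have h5 : 0 ≤ Real.log (1 + x) := Real.log_nonneg (by linarith)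
  have : 0 ≤ n * Real.log b⁻¹ * Real.log (1 + x) := by positivity
  linarith

/-- Dilation by `b ^ (-n)` adds `n log (1 / b)` to the logarithm; this linear factor is absorbed by
enlarging the ratio from `b` to `r`. -/
theorem exists_pow_mul_linear_le {b r l : ℝ} (hb0 : 0 < b) (hbr : b < r) (hl : 0 ≤ l) :
    ∃ K, 0 ≤ K ∧ ∀ n : ℕ, b ^ n * (1 + n * l) ≤ K * r ^ n := by
  have hr0 : 0 < r := hb0.trans hbr
  have h1 : |b / r| < 1 := by
    rw [abs_of_pos (by positivity), div_lt_one hr0]; exact hbr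
  have h2 : Tendsto (fun n : ℕ => (b / r) ^ n + l * (n * (b / r) ^ n)) atTop (nhds 0) := by
    have := (tendsto_pow_atTop_nhds_zero_of_abs_lt_one h1).add
      ((tendsto_self_mul_const_pow_of_abs_lt_one h1).const_mul l)
    simpa using this
  obtain ⟨K, hK⟩ := h2.bddAbove_range
  have hK' : ∀ n : ℕ, (b / r) ^ n + l * (n * (b / r) ^ n) ≤ K := fun n => hK ⟨n, rfl⟩
  have hK0 : 0 ≤ K := le_trans (by positivity) (hK' 0)
  refine ⟨K, hK0, fun n => ?_⟩
  calc b ^ n * (1 + n * l) = ((b / r) ^ n + l * (n * (b / r) ^ n)) * r ^ n := by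
        rw [div_pow]; field_simp
    _ ≤ _ := by gcongr; exact hK' n

theorem exists_pow_mul_truncMean_le {μ : Measure ℕ} [IsProbabilityMeasure μ]
    (hμ : Tendsto (fun x : ℝ => x * tailProb μ x) atTop (nhds 1)) {b r : ℝ} (hb0 : 0 < b)
    (hb1 : b < 1) (hbr : b < r) :
    ∃ K, 0 ≤ K ∧ ∀ (n : ℕ) (x : ℝ), 0 ≤ x →
      b ^ n * truncMean μ (x / b ^ n) ≤ K * r ^ n * (1 + Real.log (1 + x)) := by
  obtain ⟨C, hC0, hC⟩ := exists_tailProb_le_div hμ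
  obtain ⟨K, hK0, hK⟩ := exists_pow_mul_linear_le hb0 hbr
    (Real.log_nonneg ((one_le_inv₀ hb0).2 hb1.le))
  refine ⟨C * K, by positivity, fun n x hx => ?_⟩
  have h5 : 0 ≤ Real.log (1 + x) := Real.log_nonneg (by linarith)
  have hn : 0 < b ^ n := by positivity
  calc b ^ n * truncMean μ (x / b ^ n)
      ≤ b ^ n * (C * (1 + Real.log (1 + x / b ^ n))) := by
        gcongr
        exact truncMean_le_log hC (by positivity)
    _ ≤ b ^ n * (C * ((1 + n * Real.log b⁻¹) * (1 + Real.log (1 + x)))) := by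
        gcongr
        exact log_one_add_div_pow_le hb0 hb1 n hx
    _ = C * (b ^ n * (1 + n * Real.log b⁻¹)) * (1 + Real.log (1 + x)) := by ring
    _ ≤ C * (K * r ^ n) * (1 + Real.log (1 + x)) :=
        mul_le_mul_of_nonneg_right (mul_le_mul_of_nonneg_left (hK n) hC0) (by linarith)
    _ = _ := by ring

/-! ### Tails of all generations and of their sum. -/

section IID

variable {Ω : Type*} [MeasurableSpace Ω] {P : Measure Ω} [IsProbabilityMeasure P]
  {B : ℕ → Ω → ℕ}

theorem truncMean_generationLaw_le (hm : ∀ i, Measurable (B i)) (hind : iIndepFun B P)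
    (hid : ∀ i, IdentDistrib (B i) (B 0) P P) (hint : Integrable (fun ω => (B 0 ω : ℝ)) P)
    {b : ℝ} (hb : b = ∫ ω, (B 0 ω : ℝ) ∂P) (hb0 : 0 < b)
    (α : Measure ℕ) [IsProbabilityMeasure α] (n : ℕ) {x : ℝ} (hx : 0 ≤ x) :
    truncMean (generationLaw α (P.map (B 0)) n) x ≤ b ^ n * truncMean α (x / b ^ n) := by
  have : IsProbabilityMeasure (P.map (B 0)) :=
    Measure.isProbabilityMeasure_map (hm 0).aemeasurable
  induction n generalizing x with
  | zero => simp [generationLaw]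
  | succ n ih =>
    rw [generationLaw]
    refine (truncMean_randomSumLaw_le hm hind hid hint hb hb0 _ hx).trans ?_
    refine (mul_le_mul_of_nonneg_left (ih (x := x / b) (by positivity)) hb0.le).trans_eq ?_
    rw [div_div, pow_succ']
    ring

/-- The error function `e` is fixed before `ν`, which enters only through the linear factor `K`.
Generation `n` has `K` of order `r ^ n`, so its error decays geometrically. -/
theorem tailProb_randomSumLaw_error (hm : ∀ i, Measurable (B i)) (hind : iIndepFun B P)
    (hid : ∀ i, IdentDistrib (B i) (B 0) P P) (hint : Integrable (fun ω => (B 0 ω : ℝ)) P)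
    (hβ : Tendsto (fun x : ℝ => tailProb (P.map (B 0)) x * x * Real.log x) atTop (nhds 0))
    {θ : ℝ} (hθ0 : 0 < θ) (hθ : θ * ∫ ω, (B 0 ω : ℝ) ∂P < 1) :
    ∃ e : ℝ → ℝ, Tendsto e atTop (nhds 0) ∧ (∃ E, 0 ≤ E ∧ ∀ x, 1 ≤ x → e x ≤ E) ∧
      ∀ (ν : Measure ℕ) [IsProbabilityMeasure ν] (K : ℝ),
        (∀ x, 0 ≤ x → truncMean ν x ≤ K * (1 + Real.log (1 + x))) → ∀ x, 0 < x →
        x * tailProb (randomSumLaw ν (P.map (B 0))) x ≤ x * tailProb ν (θ * x) + K * e x := by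
  have : IsProbabilityMeasure (P.map (B 0)) :=
    Measure.isProbabilityMeasure_map (hm 0).aemeasurable
  obtain ⟨C, hC0, hC⟩ := tailProb_randomSumLaw_le hm hind hid hint hθ0 hθ
  obtain ⟨E, hE0, hE⟩ := exists_mul_log_mul_truncSq_le hβ hθ0
  refine ⟨fun x => C * (x * ((1 + Real.log (1 + θ * x)) * (truncSq (P.map (B 0)) x / x ^ 2))),
    ?_, ⟨C * E, by positivity, fun x hx => mul_le_mul_of_nonneg_left (hE x hx) hC0⟩,
    fun ν _ K hK x hx => ?_⟩
  · simpa using (tendsto_mul_log_mul_truncSq hβ hθ0).const_mul C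
  · have h1 := hK (θ * x) (by positivity)
    have h2 : 0 ≤ truncSq (P.map (B 0)) x / x ^ 2 := div_nonneg (truncSq_nonneg _ _) (sq_nonneg _)
    calc x * tailProb (randomSumLaw ν (P.map (B 0))) x
        ≤ x * (tailProb ν (θ * x) +
          C * (truncMean ν (θ * x) * (truncSq (P.map (B 0)) x / x ^ 2))) := by
          gcongr
          exact hC ν x hx
      _ ≤ x * (tailProb ν (θ * x) + C * (K * (1 + Real.log (1 + θ * x)) *
          (truncSq (P.map (B 0)) x / x ^ 2))) := by gcongr
      _ = _ := by ring

theorem tendsto_comp_mul_tailProb {ν : Measure ℕ} {c : ℝ}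
    (hν : Tendsto (fun x : ℝ => x * tailProb ν x) atTop (nhds c)) {θ : ℝ} (hθ : 0 < θ) :
    Tendsto (fun x : ℝ => x * tailProb ν (θ * x)) atTop (nhds (c * θ⁻¹)) := by
  have h := (hν.comp (tendsto_id.const_mul_atTop hθ)).mul_const θ⁻¹
  refine h.congr fun x => ?_
  simp only [Function.comp, id]
  field_simp

/-- Taking `θ = t⁻¹` in the one-step bounds squeezes the limit: `t` slightly below `b` gives the
lower bound and `t` slightly above `b` the upper one. -/
theorem tendsto_mul_tailProb_randomSumLaw (hm : ∀ i, Measurable (B i)) (hind : iIndepFun B P)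
    (hid : ∀ i, IdentDistrib (B i) (B 0) P P) (hint : Integrable (fun ω => (B 0 ω : ℝ)) P)
    (hβ : Tendsto (fun x : ℝ => tailProb (P.map (B 0)) x * x * Real.log x) atTop (nhds 0))
    {b : ℝ} (hb : b = ∫ ω, (B 0 ω : ℝ) ∂P) (hb0 : 0 < b)
    {ν : Measure ℕ} [IsProbabilityMeasure ν] {K c : ℝ}
    (hK : ∀ x, 0 ≤ x → truncMean ν x ≤ K * (1 + Real.log (1 + x)))
    (hν : Tendsto (fun x : ℝ => x * tailProb ν x) atTop (nhds c)) :
    Tendsto (fun x : ℝ => x * tailProb (randomSumLaw ν (P.map (B 0))) x) atTop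
      (nhds (c * b)) := by
  rw [tendsto_order]
  constructor
  · intro a ha
    have h1 : ∀ᶠ t in nhdsWithin b (Set.Iio b), a < c * t ∧ 0 < t :=
      ((continuousAt_const.mul continuousAt_id).eventually_const_lt ha |>.and
        (eventually_gt_nhds hb0)).filter_mono nhdsWithin_le_nhds
    obtain ⟨t, ⟨h2, ht0⟩, htb⟩ := (h1.and self_mem_nhdsWithin).exists
    have h3 : ∀ᶠ η in nhdsWithin (0 : ℝ) (Set.Ioi 0), a < (1 - η) * (c * t) := by
      have : ContinuousAt (fun η : ℝ => (1 - η) * (c * t)) 0 := by fun_prop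
      exact (this.eventually_const_lt (by simpa using h2)).filter_mono nhdsWithin_le_nhds
    obtain ⟨η, h4, hη⟩ := (h3.and self_mem_nhdsWithin).exists
    have htheta : 1 < t⁻¹ * ∫ ω, (B 0 ω : ℝ) ∂P := by
      rw [← hb, inv_mul_eq_div, one_lt_div ht0]; exact htb
    have h5 := (tendsto_comp_mul_tailProb hν (inv_pos.2 ht0)).const_mul (1 - η)
    rw [inv_inv] at h5
    filter_upwards [h5.eventually_const_lt h4, eventually_gt_atTop 0,
      eventually_le_tailProb_randomSumLaw hm hind hid hint (inv_pos.2 ht0) htheta hη ν]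
      with x h6 hx0 h7
    calc a < (1 - η) * (x * tailProb ν (t⁻¹ * x)) := h6
      _ = x * ((1 - η) * tailProb ν (t⁻¹ * x)) := by ring
      _ ≤ _ := by gcongr
  · intro a ha
    have h1 : ∀ᶠ t in nhdsWithin b (Set.Ioi b), c * t < a :=
      ((continuousAt_const.mul continuousAt_id).eventually_lt_const ha).filter_mono
        nhdsWithin_le_nhds
    obtain ⟨t, h2, htb⟩ := (h1.and self_mem_nhdsWithin).exists
    have ht0 : 0 < t := hb0.trans htb
    have htheta : t⁻¹ * ∫ ω, (B 0 ω : ℝ) ∂P < 1 := by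
      rw [← hb, inv_mul_eq_div, div_lt_one ht0]; exact htb
    obtain ⟨e, he, -, h3⟩ := tailProb_randomSumLaw_error hm hind hid hint hβ (inv_pos.2 ht0) htheta
    have h5 := (tendsto_comp_mul_tailProb hν (inv_pos.2 ht0)).add (he.const_mul K)
    rw [inv_inv, mul_zero, add_zero] at h5
    filter_upwards [h5.eventually_lt_const h2, eventually_gt_atTop 0] with x h6 hx0
    exact (h3 ν K hK x hx0).trans_lt h6

/-- Geometric control of the truncated means and tails of all generations. -/
theorem exists_generationLaw_bounds (hm : ∀ i, Measurable (B i)) (hind : iIndepFun B P)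
    (hid : ∀ i, IdentDistrib (B i) (B 0) P P) (hint : Integrable (fun ω => (B 0 ω : ℝ)) P)
    (hβ : Tendsto (fun x : ℝ => tailProb (P.map (B 0)) x * x * Real.log x) atTop (nhds 0))
    {b r : ℝ} (hb : b = ∫ ω, (B 0 ω : ℝ) ∂P) (hb0 : 0 < b) (hbr : b < r) (hr1 : r < 1)
    {α : Measure ℕ} [IsProbabilityMeasure α]
    (hα : Tendsto (fun x : ℝ => x * tailProb α x) atTop (nhds 1)) :
    ∃ K, 0 ≤ K ∧
      (∀ (n : ℕ) (x : ℝ), 0 ≤ x → truncMean (generationLaw α (P.map (B 0)) n) x ≤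
        K * r ^ n * (1 + Real.log (1 + x))) ∧
      ∀ (n : ℕ) (x : ℝ), 1 ≤ x → x * tailProb (generationLaw α (P.map (B 0)) n) x ≤
        K * ((n + 1) * r ^ n) := by
  have : IsProbabilityMeasure (P.map (B 0)) :=
    Measure.isProbabilityMeasure_map (hm 0).aemeasurable
  have hr0 : 0 < r := hb0.trans hbr
  obtain ⟨K, hK0, hK⟩ := exists_pow_mul_truncMean_le hα hb0 (hbr.trans hr1) hbr
  obtain ⟨C, hC0, hC⟩ := exists_tailProb_le_div hα
  have htheta : r⁻¹ * ∫ ω, (B 0 ω : ℝ) ∂P < 1 := by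
    rw [← hb, inv_mul_eq_div, div_lt_one hr0]; exact hbr
  obtain ⟨e, -, ⟨E, hE0, hE⟩, he⟩ :=
    tailProb_randomSumLaw_error hm hind hid hint hβ (inv_pos.2 hr0) htheta
  have hmean : ∀ (n : ℕ) (x : ℝ), 0 ≤ x → truncMean (generationLaw α (P.map (B 0)) n) x ≤
      K * r ^ n * (1 + Real.log (1 + x)) := fun n x hx =>
    (truncMean_generationLaw_le hm hind hid hint hb hb0 α n hx).trans (hK n x hx)
  -- `C` starts the induction. The term `K * E / r` ensures `K * E ≤ D * r`, so the error added at
  -- each step fits into the increase of `n + 1` to `n + 2`.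
  set D := C + K * E / r with hD
  have hD0 : 0 ≤ D := by positivity
  have hDE : K * E ≤ D * r := by
    rw [hD, add_mul, div_mul_cancel₀ _ hr0.ne']
    nlinarith
  have htail : ∀ (n : ℕ) (x : ℝ), 1 ≤ x → x * tailProb (generationLaw α (P.map (B 0)) n) x ≤
      D * ((n + 1) * r ^ n) := by
    intro n
    induction n with
    | zero =>
      intro x hx
      have h1 := hC x (by linarith)
      rw [le_div_iff₀ (by positivity)] at h1
      have h2 := tailProb_nonneg α x
      have h3 : 0 ≤ K * E / r := by positivity
      simp only [generationLaw, Nat.cast_zero, zero_add, pow_zero, mul_one]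
      linarith
    | succ n ih =>
      intro x hx
      have h1 := he (generationLaw α (P.map (B 0)) n) (K * r ^ n) (hmean n) x (by linarith)
      -- Since `r < 1`, the point `r⁻¹ * x` stays in the range where the induction hypothesis
      -- applies.
      have h2 := ih (r⁻¹ * x) (by nlinarith [(one_lt_inv₀ hr0).2 hr1])
      have h3 : K * r ^ n * e x ≤ K * r ^ n * E := by gcongr; exact hE x hx
      have h4 : x * tailProb (generationLaw α (P.map (B 0)) n) (r⁻¹ * x) ≤
          r * (D * ((n + 1) * r ^ n)) := by
        calc _ = r * (r⁻¹ * x * tailProb (generationLaw α (P.map (B 0)) n) (r⁻¹ * x)) := by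
              field_simp
          _ ≤ _ := by gcongr
      have h5 : K * E * r ^ n ≤ D * r * r ^ n := by gcongr
      rw [generationLaw]
      push_cast
      rw [pow_succ]
      linarith
  refine ⟨max K D, le_max_of_le_left hK0, fun n x hx => (hmean n x hx).trans ?_,
    fun n x hx => (htail n x hx).trans ?_⟩
  · have : 0 ≤ Real.log (1 + x) := Real.log_nonneg (by linarith)
    gcongr
    exact le_max_left _ _
  · gcongr
    exact le_max_right _ _

theorem summable_tailProb_generationLaw (hm : ∀ i, Measurable (B i)) (hind : iIndepFun B P)
    (hid : ∀ i, IdentDistrib (B i) (B 0) P P) (hint : Integrable (fun ω => (B 0 ω : ℝ)) P)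
    (hβ : Tendsto (fun x : ℝ => tailProb (P.map (B 0)) x * x * Real.log x) atTop (nhds 0))
    {b : ℝ} (hb : b = ∫ ω, (B 0 ω : ℝ) ∂P) (hb0 : 0 < b) (hb1 : b < 1)
    {α : Measure ℕ} [IsProbabilityMeasure α]
    (hα : Tendsto (fun x : ℝ => x * tailProb α x) atTop (nhds 1)) {x : ℝ} (hx : 0 ≤ x) :
    Summable fun n => tailProb (generationLaw α (P.map (B 0)) n) x := by
  have : IsProbabilityMeasure (P.map (B 0)) :=
    Measure.isProbabilityMeasure_map (hm 0).aemeasurable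
  obtain ⟨r, hbr, hr1⟩ := exists_between hb1
  have hr0 : 0 < r := hb0.trans hbr
  obtain ⟨K, hK0, hK, -⟩ := exists_generationLaw_bounds hm hind hid hint hβ hb hb0 hbr hr1 hα
  refine Summable.of_nonneg_of_le (fun n => tailProb_nonneg _ _) (fun n => ?_)
    ((summable_geometric_of_lt_one hr0.le hr1).mul_left (2 * (K * (1 + Real.log (1 + 1 / 2)))))
  -- An integer exceeding `x ≥ 0` exceeds `1 / 2`, so Markov at `1 / 2` also covers `x < 1`; this is
  -- the source of the factor `2`.
  have h1 : tailProb (generationLaw α (P.map (B 0)) n) x ≤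
      tailProb (generationLaw α (P.map (B 0)) n) (1 / 2) := by
    refine measureReal_mono fun k hk => ?_
    have hk' : x < (k : ℝ) := hk
    have h2 : 1 ≤ k := by
      rcases Nat.eq_zero_or_pos k with h | h
      · rw [h, Nat.cast_zero] at hk'; linarith
      · exact h
    have h3 : (1 : ℝ) ≤ k := by exact_mod_cast h2
    change (1 / 2 : ℝ) < k
    linarith
  have h2 := tailProb_mul_le_truncMean (generationLaw α (P.map (B 0)) n) (x := 1 / 2) (by norm_num)
  have h3 := hK n (1 / 2) (by norm_num)
  linarith

theorem tendsto_mul_tailProb_generationLaw (hm : ∀ i, Measurable (B i)) (hind : iIndepFun B P)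
    (hid : ∀ i, IdentDistrib (B i) (B 0) P P) (hint : Integrable (fun ω => (B 0 ω : ℝ)) P)
    (hβ : Tendsto (fun x : ℝ => tailProb (P.map (B 0)) x * x * Real.log x) atTop (nhds 0))
    {b : ℝ} (hb : b = ∫ ω, (B 0 ω : ℝ) ∂P) (hb0 : 0 < b) (hb1 : b < 1)
    {α : Measure ℕ} [IsProbabilityMeasure α]
    (hα : Tendsto (fun x : ℝ => x * tailProb α x) atTop (nhds 1)) (n : ℕ) :
    Tendsto (fun x : ℝ => x * tailProb (generationLaw α (P.map (B 0)) n) x) atTop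
      (nhds (b ^ n)) := by
  have : IsProbabilityMeasure (P.map (B 0)) :=
    Measure.isProbabilityMeasure_map (hm 0).aemeasurable
  obtain ⟨r, hbr, hr1⟩ := exists_between hb1
  obtain ⟨K, -, hK, -⟩ := exists_generationLaw_bounds hm hind hid hint hβ hb hb0 hbr hr1 hα
  induction n with
  | zero => simpa [generationLaw] using hα
  | succ n ih =>
    rw [pow_succ]
    exact tendsto_mul_tailProb_randomSumLaw hm hind hid hint hβ hb hb0 (hK n) ih

/-- Dominated convergence with dominating sequence `K (n + 1) r ^ n` reduces the limit to the
geometric series of the `b ^ n`. -/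
theorem tendsto_mul_tsum_tailProb_generationLaw (hm : ∀ i, Measurable (B i))
    (hind : iIndepFun B P)
    (hid : ∀ i, IdentDistrib (B i) (B 0) P P) (hint : Integrable (fun ω => (B 0 ω : ℝ)) P)
    (hβ : Tendsto (fun x : ℝ => tailProb (P.map (B 0)) x * x * Real.log x) atTop (nhds 0))
    {b : ℝ} (hb : b = ∫ ω, (B 0 ω : ℝ) ∂P) (hb0 : 0 < b) (hb1 : b < 1)
    {α : Measure ℕ} [IsProbabilityMeasure α]
    (hα : Tendsto (fun x : ℝ => x * tailProb α x) atTop (nhds 1)) :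
    Tendsto (fun x : ℝ => x * ∑' n, tailProb (generationLaw α (P.map (B 0)) n) x) atTop
      (nhds (1 - b)⁻¹) := by
  obtain ⟨r, hbr, hr1⟩ := exists_between hb1
  have hr0 : 0 < r := hb0.trans hbr
  obtain ⟨K, hK0, -, hK⟩ := exists_generationLaw_bounds hm hind hid hint hβ hb hb0 hbr hr1 hα
  rw [← tsum_geometric_of_lt_one hb0.le hb1]
  simp_rw [← tsum_mul_left]
  refine tendsto_tsum_of_dominated_convergence (bound := fun n : ℕ => K * ((n + 1) * r ^ n)) ?_
    (tendsto_mul_tailProb_generationLaw hm hind hid hint hβ hb hb0 hb1 hα) ?_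
  · have h1 : ‖r‖ < 1 := by rwa [Real.norm_of_nonneg hr0.le]
    have h2 := (summable_pow_mul_geometric_of_norm_lt_one 1 h1).add
      (summable_geometric_of_norm_lt_one h1)
    refine (h2.congr fun n => ?_).mul_left K
    ring
  · filter_upwards [eventually_ge_atTop 1] with x hx n
    rw [Real.norm_of_nonneg (mul_nonneg (by linarith) (tailProb_nonneg _ _))]
    exact hK n x hx

end IID

/-! ### Sums of two variables. -/

theorem truncMean_map {Ω : Type*} [MeasurableSpace Ω] {P : Measure Ω} {A : Ω → ℕ}
    (hA : Measurable A) (x : ℝ) :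
    truncMean (P.map A) x = ∫ ω, min (A ω : ℝ) x ∂P :=
  integral_map hA.aemeasurable measurable_from_top.aestronglyMeasurable

section Sums

variable {Ω : Type*} [MeasurableSpace Ω] {P : Measure Ω} [IsProbabilityMeasure P]
  {A S : Ω → ℕ}

/-- If neither summand exceeds `(1 - δ) y` while the sum exceeds `y`, both must exceed `δ y`; by
independence this costs a product of tails. -/
theorem tailProb_map_add_le (hA : Measurable A) (hS : Measurable S) (hAS : IndepFun A S P)
    (δ y : ℝ) :
    tailProb (P.map fun ω => A ω + S ω) y ≤ tailProb (P.map A) ((1 - δ) * y) +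
      tailProb (P.map S) ((1 - δ) * y) +
      tailProb (P.map A) (δ * y) * tailProb (P.map S) (δ * y) := by
  rw [tailProb_map (hA.fun_add hS), tailProb_map hA, tailProb_map hS, tailProb_map hA,
    tailProb_map hS]
  have h1 : P.real ({ω | δ * y < (A ω : ℝ)} ∩ {ω | δ * y < (S ω : ℝ)}) =
      P.real {ω | δ * y < (A ω : ℝ)} * P.real {ω | δ * y < (S ω : ℝ)} := by
    have := hAS.measure_inter_preimage_eq_mul {k : ℕ | δ * y < (k : ℝ)} {k : ℕ | δ * y < (k : ℝ)}
      (Set.to_countable _).measurableSet (Set.to_countable _).measurableSet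
    simp only [measureReal_def, ← ENNReal.toReal_mul]
    exact congrArg ENNReal.toReal this
  rw [← h1]
  refine (measureReal_mono (s₂ := {ω | (1 - δ) * y < (A ω : ℝ)} ∪ {ω | (1 - δ) * y < (S ω : ℝ)} ∪
    ({ω | δ * y < (A ω : ℝ)} ∩ {ω | δ * y < (S ω : ℝ)})) fun ω hω => ?_).trans
    ((measureReal_union_le _ _).trans (add_le_add_left (measureReal_union_le _ _) _))
  have h2 : y < ((A ω + S ω : ℕ) : ℝ) := hω
  push_cast at h2
  by_cases h3 : (1 - δ) * y < (A ω : ℝ)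
  · exact Or.inl (Or.inl h3)
  by_cases h4 : (1 - δ) * y < (S ω : ℝ)
  · exact Or.inl (Or.inr h4)
  refine Or.inr ⟨?_, ?_⟩
  · change δ * y < (A ω : ℝ)
    linarith
  · change δ * y < (S ω : ℝ)
    linarith

theorem le_tailProb_map_add (hA : Measurable A) (hS : Measurable S) (hAS : IndepFun A S P)
    (y : ℝ) :
    tailProb (P.map A) y + tailProb (P.map S) y * (1 - tailProb (P.map A) y) ≤
      tailProb (P.map fun ω => A ω + S ω) y := by
  rw [tailProb_map (hA.fun_add hS), tailProb_map hA, tailProb_map hS]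
  have hmS : MeasurableSet {ω | y < (S ω : ℝ)} :=
    hS (t := {k : ℕ | y < (k : ℝ)}) (Set.to_countable _).measurableSet
  have h1 : P.real ({ω | y < (A ω : ℝ)} ∩ {ω | y < (S ω : ℝ)}) =
      P.real {ω | y < (A ω : ℝ)} * P.real {ω | y < (S ω : ℝ)} := by
    have := hAS.measure_inter_preimage_eq_mul {k : ℕ | y < (k : ℝ)} {k : ℕ | y < (k : ℝ)}
      (Set.to_countable _).measurableSet (Set.to_countable _).measurableSet
    simp only [measureReal_def, ← ENNReal.toReal_mul]
    exact congrArg ENNReal.toReal this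
  have h2 := measureReal_union_add_inter (μ := P) (s := {ω | y < (A ω : ℝ)}) hmS
  have h3 : P.real ({ω | y < (A ω : ℝ)} ∪ {ω | y < (S ω : ℝ)}) ≤
      P.real {ω | y < ((A ω + S ω : ℕ) : ℝ)} := by
    refine measureReal_mono fun ω hω => ?_
    change y < ((A ω + S ω : ℕ) : ℝ)
    push_cast
    have hA0 : (0 : ℝ) ≤ A ω := Nat.cast_nonneg _
    have hS0 : (0 : ℝ) ≤ S ω := Nat.cast_nonneg _
    rcases hω with h | h
    · have : y < (A ω : ℝ) := h
      linarith
    · have : y < (S ω : ℝ) := h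
      linarith
  rw [h1] at h2
  linarith

theorem integrable_min_comp (hA : Measurable A) {x : ℝ} (hx : 0 ≤ x) :
    Integrable (fun ω => min (A ω : ℝ) x) P :=
  Integrable.of_bound ((measurable_from_top (f := fun k : ℕ => min (k : ℝ) x)).comp
    hA).aestronglyMeasurable x (ae_of_all _ fun _ => abs_min_natCast_le hx _)

theorem truncMean_map_add_le (hA : Measurable A) (hS : Measurable S) {x : ℝ} (hx : 0 ≤ x) :
    truncMean (P.map fun ω => A ω + S ω) x ≤ truncMean (P.map A) x + truncMean (P.map S) x := by
  rw [truncMean_map (hA.fun_add hS), truncMean_map hA, truncMean_map hS,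
    ← integral_add (integrable_min_comp hA hx) (integrable_min_comp hS hx)]
  refine integral_mono (integrable_min_comp (hA.fun_add hS) hx)
    ((integrable_min_comp hA hx).add (integrable_min_comp hS hx)) fun ω => ?_
  have hA0 : (0 : ℝ) ≤ A ω := Nat.cast_nonneg _
  have hS0 : (0 : ℝ) ≤ S ω := Nat.cast_nonneg _
  simp only [Nat.cast_add]
  rcases le_total (A ω : ℝ) x with h1 | h1
  · rcases le_total (S ω : ℝ) x with h2 | h2
    · rw [min_eq_left h1, min_eq_left h2]; exact min_le_left _ _
    · rw [min_eq_right h2]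
      exact (min_le_right _ _).trans (by linarith [le_min hA0 hx])
  · rw [min_eq_right h1]
    exact (min_le_right _ _).trans (by linarith [le_min hS0 hx])

theorem setIntegral_le_truncMean (hA : Measurable A) {y : ℝ} (hy : 0 ≤ y) :
    ∫ ω in {ω | (A ω : ℝ) ≤ y}, (A ω : ℝ) ∂P ≤ truncMean (P.map A) y := by
  have hs : MeasurableSet {ω | (A ω : ℝ) ≤ y} :=
    hA (t := {k : ℕ | (k : ℝ) ≤ y}) (Set.to_countable _).measurableSet
  rw [truncMean_map hA, ← integral_indicator hs]
  refine integral_mono_of_nonneg (ae_of_all _ fun ω => ?_) (integrable_min_comp hA hy)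
    (ae_of_all _ fun ω => ?_)
  · exact Set.indicator_nonneg (fun ω _ => Nat.cast_nonneg _) ω
  · by_cases h : (A ω : ℝ) ≤ y
    · rw [Set.indicator_of_mem (show ω ∈ {ω | (A ω : ℝ) ≤ y} from h)]
      exact le_min le_rfl h
    · rw [Set.indicator_of_notMem (show ω ∉ {ω | (A ω : ℝ) ≤ y} from h)]
      exact le_min (Nat.cast_nonneg _) hy

end Sums

/-! ### Iteration of scaling inequalities. -/

/-- The integrand equals `min (b ^ n * k) x`, which is bounded by `x` and tends to `0` pointwise.
The remainder of the iteration thus vanishes with no moment assumption on `μ`. -/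
theorem tendsto_pow_mul_truncMean (μ : Measure ℕ) [IsProbabilityMeasure μ] {b : ℝ} (hb0 : 0 < b)
    (hb1 : b < 1) {x : ℝ} (hx : 0 ≤ x) :
    Tendsto (fun n : ℕ => b ^ n * truncMean μ (x / b ^ n)) atTop (nhds 0) := by
  simp_rw [truncMean, ← integral_const_mul]
  have h : Tendsto (fun n : ℕ => ∫ k : ℕ, b ^ n * min (k : ℝ) (x / b ^ n) ∂μ) atTop
      (nhds (∫ _, (0 : ℝ) ∂μ)) := by
    refine tendsto_integral_of_dominated_convergence (fun _ => x)
      (fun n => measurable_from_top.aestronglyMeasurable) (integrable_const _)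
      (fun n => ae_of_all _ fun k => ?_) (ae_of_all _ fun k => ?_)
    · have hn : 0 < b ^ n := by positivity
      have h1 := abs_min_natCast_le (x := x / b ^ n) (by positivity) k
      rw [norm_mul, Real.norm_of_nonneg hn.le, Real.norm_eq_abs]
      calc _ ≤ b ^ n * (x / b ^ n) := by gcongr
        _ = x := mul_div_cancel₀ _ hn.ne'
    · have h1 := (tendsto_pow_atTop_nhds_zero_of_lt_one hb0.le hb1).mul_const (k : ℝ)
      rw [zero_mul] at h1
      refine squeeze_zero (fun n => ?_) (fun n => ?_) h1
      · have : (0 : ℝ) ≤ min (k : ℝ) (x / b ^ n) := le_min k.cast_nonneg (by positivity)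
        positivity
      · gcongr
        exact min_le_left _ _
  simpa using h

/-- Iterating `f x ≤ g x + b * f (x / b)`. -/
theorem le_sum_add_of_le_add_mul {f g : ℝ → ℝ} {b : ℝ} (hb0 : 0 < b)
    (h : ∀ x, 0 ≤ x → f x ≤ g x + b * f (x / b)) (n : ℕ) {x : ℝ} (hx : 0 ≤ x) :
    f x ≤ ∑ j ∈ Finset.range n, b ^ j * g (x / b ^ j) + b ^ n * f (x / b ^ n) := by
  induction n with
  | zero => simp
  | succ n ih =>
    rw [Finset.sum_range_succ]
    have h1 := h (x / b ^ n) (by positivity)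
    rw [div_div, ← pow_succ] at h1
    have h2 : b ^ n * f (x / b ^ n) ≤ b ^ n * (g (x / b ^ n) + b * f (x / b ^ (n + 1))) := by
      gcongr
    refine ih.trans ((add_le_add_right h2 _).trans_eq ?_)
    rw [pow_succ]; ring

/-- Iterating along `y, y / t, y / t ^ 2, …` sums the errors to `(κ / y) ∑ t ^ j`, and the remainder
disappears because `f → 0`. -/
theorem le_div_of_le_tail_add {f : ℝ → ℝ} {κ t y₀ : ℝ} (hf : Tendsto f atTop (nhds 0))
    (ht0 : 0 < t) (ht1 : t < 1) (hy₀ : 0 < y₀)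
    (h : ∀ y, y₀ ≤ y → f y ≤ f (t⁻¹ * y) + κ / y) {y : ℝ} (hy : y₀ ≤ y) :
    y * f y ≤ κ / (1 - t) := by
  have hy0 : 0 < y := hy₀.trans_le hy
  have ht : 1 < t⁻¹ := (one_lt_inv₀ ht0).2 ht1
  have h1 : ∀ n : ℕ, y * f y ≤ y * f (t⁻¹ ^ n * y) + κ * ∑ j ∈ Finset.range n, t ^ j := by
    intro n
    induction n with
    | zero => simp
    | succ n ih =>
      have h2 : 1 ≤ t⁻¹ ^ n := one_le_pow₀ ht.le
      have h3 := h (t⁻¹ ^ n * y) (by nlinarith)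
      have h4 : y * f (t⁻¹ ^ n * y) ≤ y * (f (t⁻¹ * (t⁻¹ ^ n * y)) + κ / (t⁻¹ ^ n * y)) := by
        gcongr
      rw [Finset.sum_range_succ, pow_succ']
      refine (ih.trans (add_le_add_left h4 _)).trans_eq ?_
      have h5 : y * (κ / (t⁻¹ ^ n * y)) = κ * t ^ n := by
        rw [inv_pow]; field_simp
      rw [← mul_assoc t⁻¹, mul_add, h5]
      ring
  have h5 : Tendsto (fun n : ℕ => y * f (t⁻¹ ^ n * y) + κ * ∑ j ∈ Finset.range n, t ^ j) atTop
      (nhds (y * 0 + κ * (1 - t)⁻¹)) :=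
    ((hf.comp ((tendsto_pow_atTop_atTop_of_one_lt ht).atTop_mul_const hy0)).const_mul y).add
      ((hasSum_geometric_of_lt_one ht0.le ht1).tendsto_sum_nat.const_mul κ)
  have := ge_of_tendsto' h5 h1
  rwa [mul_zero, zero_add, ← div_eq_mul_inv] at this

/-- The same iteration from below; each step also loses a factor `q`, and the remainder is discarded
since `f ≥ 0`. -/
theorem div_le_of_tail_add_le {f : ℝ → ℝ} {p q t y₀ : ℝ} (hf : ∀ y, 0 ≤ f y)
    (ht0 : 0 < t) (ht1 : t < 1) (hq0 : 0 ≤ q) (hq1 : q ≤ 1) (hy₀ : 0 < y₀)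
    (h : ∀ y, y₀ ≤ y → p / y + q * f (t⁻¹ * y) ≤ f y) {y : ℝ} (hy : y₀ ≤ y) :
    p / (1 - q * t) ≤ y * f y := by
  have hy0 : 0 < y := hy₀.trans_le hy
  have ht : 1 < t⁻¹ := (one_lt_inv₀ ht0).2 ht1
  have hqt : q * t < 1 := by nlinarith
  have h1 : ∀ n : ℕ, p * ∑ j ∈ Finset.range n, (q * t) ^ j + y * (q ^ n * f (t⁻¹ ^ n * y)) ≤
      y * f y := by
    intro n
    induction n with
    | zero => simp
    | succ n ih =>
      have h2 : 1 ≤ t⁻¹ ^ n := one_le_pow₀ ht.le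
      have h3 := h (t⁻¹ ^ n * y) (by nlinarith)
      have h4 : y * (q ^ n * (p / (t⁻¹ ^ n * y) + q * f (t⁻¹ * (t⁻¹ ^ n * y)))) ≤
          y * (q ^ n * f (t⁻¹ ^ n * y)) := by
        gcongr
      refine le_trans (le_of_eq ?_) ((add_le_add_right h4 _).trans ih)
      have h5 : y * (p / (t⁻¹ ^ n * y)) = p * t ^ n := by
        rw [inv_pow]; field_simp
      rw [Finset.sum_range_succ, pow_succ' t⁻¹, ← mul_assoc t⁻¹, mul_pow]
      linear_combination -(q ^ n) * h5
  have h5 : Tendsto (fun n : ℕ => p * ∑ j ∈ Finset.range n, (q * t) ^ j) atTop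
      (nhds (p * (1 - q * t)⁻¹)) :=
    (hasSum_geometric_of_lt_one (mul_nonneg hq0 ht0.le) hqt).tendsto_sum_nat.const_mul p
  rw [div_eq_mul_inv]
  refine le_of_tendsto' h5 fun n => le_trans ?_ (h1 n)
  have : 0 ≤ y * (q ^ n * f (t⁻¹ ^ n * y)) :=
    mul_nonneg hy0.le (mul_nonneg (pow_nonneg hq0 n) (hf _))
  linarith

/-! ### The fixed-point equation. -/

section FixedPoint

variable {Ω : Type*} [MeasurableSpace Ω] {P : Measure Ω} [IsProbabilityMeasure P]
  {A S : Ω → ℕ} {B : ℕ → Ω → ℕ}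

/-- The one-step error estimate needs logarithmic growth of the truncated mean of `ξ`. It comes from
iterating `truncMean ξ x ≤ truncMean (P.map A) x + b * truncMean ξ (x / b)`, whose inhomogeneous
terms are dominated by a geometric series in `r`. -/
theorem exists_truncMean_fixedPoint_le (hm : ∀ i, Measurable (B i)) (hind : iIndepFun B P)
    (hid : ∀ i, IdentDistrib (B i) (B 0) P P) (hint : Integrable (fun ω => (B 0 ω : ℝ)) P)
    {b : ℝ} (hb : b = ∫ ω, (B 0 ω : ℝ) ∂P) (hb0 : 0 < b) (hb1 : b < 1)
    (hA : Measurable A) (hS : Measurable S)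
    (hα : Tendsto (fun x : ℝ => x * tailProb (P.map A) x) atTop (nhds 1))
    {ξ : Measure ℕ} [IsProbabilityMeasure ξ] (hSξ : P.map S = randomSumLaw ξ (P.map (B 0)))
    (hξ : ξ = P.map fun ω => A ω + S ω) :
    ∃ K, ∀ x, 0 ≤ x → truncMean ξ x ≤ K * (1 + Real.log (1 + x)) := by
  have : IsProbabilityMeasure (P.map A) := Measure.isProbabilityMeasure_map hA.aemeasurable
  obtain ⟨r, hbr, hr1⟩ := exists_between hb1
  have hr0 : 0 < r := hb0.trans hbr
  obtain ⟨K, hK0, hK⟩ := exists_pow_mul_truncMean_le hα hb0 hb1 hbr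
  have hstep : ∀ x, 0 ≤ x → truncMean ξ x ≤ truncMean (P.map A) x + b * truncMean ξ (x / b) := by
    intro x hx
    have h1 := truncMean_map_add_le (P := P) hA hS hx
    rw [← hξ, hSξ] at h1
    linarith [truncMean_randomSumLaw_le hm hind hid hint hb hb0 ξ hx]
  refine ⟨K * (1 - r)⁻¹, fun x hx => ?_⟩
  have hl : 0 ≤ Real.log (1 + x) := Real.log_nonneg (by linarith)
  have h1 : ∀ n : ℕ, truncMean ξ x ≤
      K * (1 - r)⁻¹ * (1 + Real.log (1 + x)) + b ^ n * truncMean ξ (x / b ^ n) := by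
    intro n
    refine (le_sum_add_of_le_add_mul hb0 hstep n hx).trans (add_le_add_left ?_ _)
    calc ∑ j ∈ Finset.range n, b ^ j * truncMean (P.map A) (x / b ^ j)
        ≤ ∑ j ∈ Finset.range n, K * r ^ j * (1 + Real.log (1 + x)) :=
          Finset.sum_le_sum fun j _ => hK j x hx
      _ = K * (∑ j ∈ Finset.range n, r ^ j) * (1 + Real.log (1 + x)) := by
          rw [← Finset.sum_mul, Finset.mul_sum]
      _ ≤ _ := by
          gcongr
          rw [← tsum_geometric_of_lt_one hr0.le hr1]
          exact (summable_geometric_of_lt_one hr0.le hr1).sum_le_tsum _ fun j _ => by positivity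
  have h2 := (tendsto_pow_mul_truncMean ξ hb0 hb1 hx).const_add
    (K * (1 - r)⁻¹ * (1 + Real.log (1 + x)))
  rw [add_zero] at h2
  exact ge_of_tendsto' h2 h1

theorem tendsto_mul_tailProb_fixedPoint (hm : ∀ i, Measurable (B i)) (hind : iIndepFun B P)
    (hid : ∀ i, IdentDistrib (B i) (B 0) P P) (hint : Integrable (fun ω => (B 0 ω : ℝ)) P)
    (hβ : Tendsto (fun x : ℝ => tailProb (P.map (B 0)) x * x * Real.log x) atTop (nhds 0))
    {b : ℝ} (hb : b = ∫ ω, (B 0 ω : ℝ) ∂P) (hb0 : 0 < b) (hb1 : b < 1)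
    (hA : Measurable A) (hS : Measurable S) (hAS : IndepFun A S P)
    (hα : Tendsto (fun x : ℝ => x * tailProb (P.map A) x) atTop (nhds 1))
    {ξ : Measure ℕ} [IsProbabilityMeasure ξ] (hSξ : P.map S = randomSumLaw ξ (P.map (B 0)))
    (hξ : ξ = P.map fun ω => A ω + S ω) :
    Tendsto (fun x : ℝ => x * tailProb ξ x) atTop (nhds (1 - b)⁻¹) := by
  have : IsProbabilityMeasure (P.map A) := Measure.isProbabilityMeasure_map hA.aemeasurable
  have : IsProbabilityMeasure (P.map S) := Measure.isProbabilityMeasure_map hS.aemeasurable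
  obtain ⟨K, hK⟩ := exists_truncMean_fixedPoint_le hm hind hid hint hb hb0 hb1 hA hS hα hSξ hξ
  rw [tendsto_order]
  constructor
  · intro a ha
    have h1 : ∀ᶠ t in nhdsWithin b (Set.Iio b), a < (1 - t)⁻¹ ∧ 0 < t := by
      have hc : ContinuousAt (fun t : ℝ => (1 - t)⁻¹) b :=
        (continuousAt_const.sub continuousAt_id).inv₀ (by simpa using (sub_pos.2 hb1).ne')
      exact ((hc.eventually_const_lt ha).and (eventually_gt_nhds hb0)).filter_mono
        nhdsWithin_le_nhds
    obtain ⟨t, ⟨h2, ht0⟩, htb⟩ := (h1.and self_mem_nhdsWithin).exists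
    have htb' : t < b := htb
    have ht1 : t < 1 := htb'.trans hb1
    -- One `p` is lost in the tail of `A`; the `p ^ 2` combines the law of large numbers with the
    -- factor `1 - P(A > y)` from inclusion–exclusion.
    have h3 : ∀ᶠ p in nhdsWithin (1 : ℝ) (Set.Iio 1), a < p / (1 - p ^ 2 * t) ∧ 0 < p := by
      have hc : ContinuousAt (fun p : ℝ => p / (1 - p ^ 2 * t)) 1 := by
        refine ContinuousAt.div (by fun_prop) (by fun_prop) ?_
        simpa using (sub_pos.2 ht1).ne'
      exact ((hc.eventually_const_lt (by simpa using h2)).and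
        (eventually_gt_nhds one_pos)).filter_mono nhdsWithin_le_nhds
    obtain ⟨p, ⟨h4, hp0⟩, hp1⟩ := (h3.and self_mem_nhdsWithin).exists
    have hp1' : p < 1 := hp1
    have htheta : 1 < t⁻¹ * ∫ ω, (B 0 ω : ℝ) ∂P := by
      rw [← hb, inv_mul_eq_div, one_lt_div ht0]; exact htb
    obtain ⟨y₀, hy₀⟩ := eventually_atTop.1 ((eventually_gt_atTop (0 : ℝ)).and
      ((hα.eventually_const_le hp1').and
      (((tendsto_tailProb_atTop (P.map A)).eventually_le_const (sub_pos.2 hp1')).and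
      (eventually_le_tailProb_randomSumLaw hm hind hid hint (inv_pos.2 ht0) htheta
        (sub_pos.2 hp1') ξ))))
    filter_upwards [eventually_ge_atTop y₀] with y hy
    refine h4.trans_le (div_le_of_tail_add_le (f := tailProb ξ) (tailProb_nonneg ξ) ht0 ht1
      (sq_nonneg p) (pow_le_one₀ hp0.le hp1'.le) (hy₀ y₀ le_rfl).1 (fun y hy => ?_) hy)
    obtain ⟨hy0, h5, h6, h7⟩ := hy₀ y hy
    have h8 := le_tailProb_map_add hA hS hAS y
    rw [← hξ, hSξ] at h8
    rw [sub_sub_cancel] at h7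
    have h9 : p / y ≤ tailProb (P.map A) y := by
      rw [div_le_iff₀ hy0]; linarith
    have h10 : p ^ 2 * tailProb ξ (t⁻¹ * y) ≤
        tailProb (randomSumLaw ξ (P.map (B 0))) y * (1 - tailProb (P.map A) y) := by
      calc p ^ 2 * tailProb ξ (t⁻¹ * y) = p * tailProb ξ (t⁻¹ * y) * p := by ring
        _ ≤ _ := mul_le_mul h7 (by linarith) hp0.le (tailProb_nonneg _ _)
    linarith
  · intro a ha
    have h1 : ∀ᶠ t in nhdsWithin b (Set.Ioi b), (1 - t)⁻¹ < a ∧ t < 1 := by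
      have hc : ContinuousAt (fun t : ℝ => (1 - t)⁻¹) b :=
        (continuousAt_const.sub continuousAt_id).inv₀ (by simpa using (sub_pos.2 hb1).ne')
      exact ((hc.eventually_lt_const ha).and (eventually_lt_nhds hb1)).filter_mono
        nhdsWithin_le_nhds
    obtain ⟨t, ⟨h2, ht1⟩, htb⟩ := (h1.and self_mem_nhdsWithin).exists
    have htb' : b < t := htb
    have ht0 : 0 < t := hb0.trans htb'
    have h3 : ∀ᶠ κ in nhdsWithin (1 : ℝ) (Set.Ioi 1), κ / (1 - t) < a := by
      have hc : ContinuousAt (fun κ : ℝ => κ / (1 - t)) 1 := by fun_prop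
      exact (hc.eventually_lt_const (by simpa using h2)).filter_mono nhdsWithin_le_nhds
    obtain ⟨κ, h4, hκ⟩ := (h3.and self_mem_nhdsWithin).exists
    have hκ' : 1 < κ := hκ
    -- Splitting at `(1 - δ) y` inflates the tail of `A` by `(1 - δ)⁻¹`, which `κ` absorbs. With `θ
    -- = ((1 - δ) t)⁻¹` the one-step bound at `(1 - δ) y` lands exactly at `t⁻¹ y`, and `b < (1 - δ)
    -- t` is the requirement `θ b < 1`.
    have h5 : ∀ᶠ δ in nhdsWithin (0 : ℝ) (Set.Ioi 0), (1 - δ)⁻¹ < κ ∧ b < (1 - δ) * t ∧ δ < 1 := by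
      have hc : ContinuousAt (fun δ : ℝ => (1 - δ)⁻¹) 0 :=
        (continuousAt_const.sub continuousAt_id).inv₀ (by simp)
      have hc' : ContinuousAt (fun δ : ℝ => (1 - δ) * t) 0 := by fun_prop
      exact ((hc.eventually_lt_const (by simpa using hκ')).and
        ((hc'.eventually_const_lt (by simpa using htb')).and
        (eventually_lt_nhds one_pos))).filter_mono nhdsWithin_le_nhds
    obtain ⟨δ, ⟨h6, h7, hδ1⟩, hδ⟩ := (h5.and self_mem_nhdsWithin).exists
    have hδ0 : 0 < δ := hδ
    have hδ1' : 0 < 1 - δ := sub_pos.2 hδ1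
    have hs0 : 0 < (1 - δ) * t := by positivity
    have htheta : ((1 - δ) * t)⁻¹ * ∫ ω, (B 0 ω : ℝ) ∂P < 1 := by
      rw [← hb, inv_mul_eq_div, div_lt_one hs0]; exact h7
    obtain ⟨e, he, -, h8⟩ := tailProb_randomSumLaw_error hm hind hid hint hβ (inv_pos.2 hs0) htheta
    have hsum : Tendsto (fun y : ℝ => y * tailProb (P.map A) ((1 - δ) * y) +
        (1 - δ)⁻¹ * (K * e ((1 - δ) * y)) +
        y * tailProb (P.map A) (δ * y) * tailProb (P.map S) (δ * y)) atTop
        (nhds (1 * (1 - δ)⁻¹ + (1 - δ)⁻¹ * (K * 0) + 1 * δ⁻¹ * 0)) :=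
      ((tendsto_comp_mul_tailProb hα hδ1').add
        (((he.comp (tendsto_id.const_mul_atTop hδ1')).const_mul K).const_mul _)).add
        ((tendsto_comp_mul_tailProb hα hδ0).mul
        ((tendsto_tailProb_atTop (P.map S)).comp (tendsto_id.const_mul_atTop hδ0)))
    obtain ⟨y₀, hy₀⟩ := eventually_atTop.1 ((eventually_gt_atTop (0 : ℝ)).and
      (hsum.eventually_le_const (show _ < κ by simpa using h6)))
    filter_upwards [eventually_ge_atTop y₀] with y hy
    refine (le_div_of_le_tail_add (tendsto_tailProb_atTop ξ) ht0 ht1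
      (hy₀ y₀ le_rfl).1 (fun y hy => ?_) hy).trans_lt h4
    obtain ⟨hy0, h9⟩ := hy₀ y hy
    have h10 := tailProb_map_add_le hA hS hAS δ y
    rw [← hξ] at h10
    have h11 := h8 ξ K hK ((1 - δ) * y) (by positivity)
    rw [← hSξ, show ((1 - δ) * t)⁻¹ * ((1 - δ) * y) = t⁻¹ * y by field_simp] at h11
    have h12 : y * tailProb (P.map S) ((1 - δ) * y) ≤
        y * tailProb ξ (t⁻¹ * y) + (1 - δ)⁻¹ * (K * e ((1 - δ) * y)) := by
      have := mul_le_mul_of_nonneg_left h11 (inv_pos.2 hδ1').le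
      refine le_trans (le_of_eq ?_) (this.trans_eq ?_) <;> field_simp
    have h13 : y * tailProb ξ y ≤ y * tailProb ξ (t⁻¹ * y) + κ := by
      have := mul_le_mul_of_nonneg_left h10 hy0.le
      linarith
    have h14 : tailProb ξ (t⁻¹ * y) + κ / y = (y * tailProb ξ (t⁻¹ * y) + κ) / y := by
      field_simp
    rw [h14, le_div_iff₀ hy0]
    linarith

end FixedPoint

/-! ### Translation of the hypotheses, and conclusion. -/

theorem isEquivalent_of_tendsto_id_mul {f g : ℝ → ℝ} {c : ℝ} (hc : c ≠ 0)
    (hf : Tendsto (fun x => x * f x) atTop (nhds c))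
    (hg : Tendsto (fun x => x * g x) atTop (nhds c)) : f ~[atTop] g := by
  have h1 := (isEquivalent_const_iff_tendsto hc).2 hf
  have h2 := (isEquivalent_const_iff_tendsto hc).2 hg
  have h3 := (IsEquivalent.refl (u := fun x : ℝ => x⁻¹) (l := atTop)).mul (h1.trans h2.symm)
  refine (h3.congr_left ?_).congr_right ?_
  all_goals
    filter_upwards [eventually_gt_atTop 0] with x hx
    simp only [Pi.mul_apply]
    field_simp

theorem measurable_sum_range : Measurable fun p : ℕ × (ℕ → ℕ) => ∑ i ∈ Finset.range p.1, p.2 i :=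
  measurable_from_prod_countable_right fun k =>
    Finset.measurable_sum (Finset.range k) fun i _ => measurable_pi_apply i

theorem tendsto_mul_tailProb_of_isEquivalent {Ω : Type*} [MeasurableSpace Ω] {P : Measure Ω}
    {A : Ω → ℕ} (hA_meas : Measurable A)
    (hA_tail : (fun x : ℝ => P.real {ω | x < (A ω : ℝ)}) ~[atTop] fun x => (1 + x)⁻¹) :
    Tendsto (fun x : ℝ => x * tailProb (P.map A) x) atTop (nhds 1) := by
  simp_rw [tailProb_map hA_meas]
  refine ((IsEquivalent.refl (u := fun x : ℝ => x)).mul hA_tail).symm.tendsto_nhds ?_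
  have h1 : Tendsto (fun x : ℝ => 1 - (1 + x)⁻¹) atTop (nhds (1 - 0)) :=
    (tendsto_inv_atTop_zero.comp (tendsto_atTop_add_const_left _ 1 tendsto_id)).const_sub 1
  rw [sub_zero] at h1
  refine h1.congr' ?_
  filter_upwards [eventually_gt_atTop 0] with x hx
  simp only [Pi.mul_apply]
  field_simp
  ring

/-- `L x * log x` is equivalent to `(log x) ^ (-ε)`, which tends to `0`. -/
theorem tendsto_tailProb_mul_log_of_slowlyVarying {Ω : Type*} [MeasurableSpace Ω]
    {P : Measure Ω} {Y : Ω → ℕ} {L : ℝ → ℝ} {ε : ℝ} (hY : Measurable Y)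
    (hL : IsSlowlyVarying L) (hε : 0 < ε)
    (hL_equiv : L ~[atTop] fun x => Real.log x ^ (-1 - ε))
    (hY_tail : ∀ x : ℝ, 0 < x → P.real {ω | x < (Y ω : ℝ)} = L x / (1 + x)) :
    Tendsto (fun x : ℝ => tailProb (P.map Y) x * x * Real.log x) atTop (nhds 0) := by
  have h1 : Tendsto (fun x : ℝ => L x * Real.log x) atTop (nhds 0) := by
    refine (hL_equiv.mul (IsEquivalent.refl (u := Real.log))).symm.tendsto_nhds ?_
    refine ((tendsto_rpow_neg_atTop hε).comp Real.tendsto_log_atTop).congr' ?_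
    filter_upwards [Real.tendsto_log_atTop.eventually_gt_atTop 0] with x hx
    simp only [Pi.mul_apply, Function.comp]
    rw [← Real.rpow_add_one hx.ne']
    congr 1; ring
  refine squeeze_zero' ?_ ?_ h1
  · filter_upwards [eventually_ge_atTop 1] with x hx
    have := Real.log_nonneg hx
    have := tailProb_nonneg (P.map Y) x
    positivity
  · filter_upwards [eventually_ge_atTop 1] with x hx
    have h2 := Real.log_nonneg hx
    have h3 := hL.pos x (by linarith)
    rw [tailProb_map hY, hY_tail x (by linarith)]
    gcongr
    rw [div_mul_eq_mul_div, div_le_iff₀ (by linarith)]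
    gcongr
    linarith

/-- The summand carrying the jump of `B` is `O(log x) · o(1 / (x log x))`, hence negligible; the
limit comes from the tail of `A` at `x / b ^ n` alone. -/
theorem tendsto_mul_singleJump {Ω : Type*} [MeasurableSpace Ω] {P : Measure Ω}
    [IsProbabilityMeasure P] {A : Ω → ℕ} (hA_meas : Measurable A)
    (hα : Tendsto (fun x : ℝ => x * tailProb (P.map A) x) atTop (nhds 1))
    {β : Measure ℕ} [IsProbabilityMeasure β]
    (hβ : Tendsto (fun x : ℝ => tailProb β x * x * Real.log x) atTop (nhds 0))
    {b : ℝ} (hb_pos : 0 < b) (n : ℕ) :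
    Tendsto (fun x : ℝ => x * ((∫ ω in {ω | (A ω : ℝ) ≤ x * b ^ (-(n : ℤ))}, (A ω : ℝ) ∂P) *
      ((n : ℝ) * b ^ (n - 1)) * tailProb β x + tailProb (P.map A) (x * b ^ (-(n : ℤ)))))
      atTop (nhds (b ^ n)) := by
  have hA_prob : IsProbabilityMeasure (P.map A) :=
    Measure.isProbabilityMeasure_map hA_meas.aemeasurable
  have hbn : 0 < (b ^ n)⁻¹ := by positivity
  obtain ⟨C, hC0, hC⟩ := exists_tailProb_le_div hα
  have h1 : Tendsto (fun x : ℝ => x * ((∫ ω in {ω | (A ω : ℝ) ≤ x * b ^ (-(n : ℤ))},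
      (A ω : ℝ) ∂P) * tailProb (β) x)) atTop (nhds 0) := by
    have h2 := (tendsto_mul_log_mul_truncSq hβ hbn).const_mul C
    rw [mul_zero] at h2
    refine squeeze_zero' ?_ ?_ h2
    · filter_upwards [eventually_ge_atTop 0] with x hx
      exact mul_nonneg hx (mul_nonneg (integral_nonneg fun ω => Nat.cast_nonneg _)
        (tailProb_nonneg _ _))
    · filter_upwards [eventually_gt_atTop 0] with x hx
      have hy : x * b ^ (-(n : ℤ)) = (b ^ n)⁻¹ * x := by
        rw [zpow_neg, zpow_natCast, mul_comm]
      have hy0 : 0 ≤ (b ^ n)⁻¹ * x := by positivity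
      rw [hy]
      have h3 := (setIntegral_le_truncMean (P := P) hA_meas hy0).trans (truncMean_le_log hC hy0)
      have h4 := tailProb_le_truncSq_div (β) hx
      have h5 := tailProb_nonneg (β) x
      have h6 : 0 ≤ Real.log (1 + (b ^ n)⁻¹ * x) := Real.log_nonneg (by linarith)
      calc _ ≤ x * (C * (1 + Real.log (1 + (b ^ n)⁻¹ * x)) *
            (truncSq (β) x / x ^ 2)) := by gcongr
        _ = _ := by ring
  have h7 := (h1.const_mul ((n : ℝ) * b ^ (n - 1))).add (tendsto_comp_mul_tailProb hα hbn)
  rw [mul_zero, zero_add, one_mul, inv_inv] at h7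
  refine h7.congr fun x => ?_
  rw [zpow_neg, zpow_natCast, mul_comm (b ^ n)⁻¹ x]
  ring

theorem theorem3p8 {Ω : Type*} [MeasurableSpace Ω] (P : Measure Ω) [IsProbabilityMeasure P]
    (A X : Ω → ℕ) (B : ℕ → Ω → ℕ) (L : ℝ → ℝ) (ε b : ℝ)
    (hA_meas : Measurable A) (hX_meas : Measurable X) (hB_meas : ∀ i, Measurable (B i))
    -- the `B i` are i.i.d., `X` is independent of `(B i)`, and `A` is independent of `(X, (B i))`
    (hB_indep : iIndepFun B P) (hB_ident : ∀ i, IdentDistrib (B i) (B 0) P P)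
    (hXB : IndepFun X (fun ω i => B i ω) P)
    (hAXB : IndepFun A (fun ω => (X ω, fun i => B i ω)) P)
    -- the fixed-point equation
    (hfix : IdentDistrib X (fun ω => A ω + ∑ i ∈ Finset.range (X ω), B i ω) P P)
    -- the boundary tails and the mean of the offspring law
    (hA_tail : (fun x : ℝ => P.real {ω | x < (A ω : ℝ)}) ~[atTop] fun x => (1 + x)⁻¹)
    (hL : IsSlowlyVarying L) (hε : 0 < ε)
    (hL_equiv : L ~[atTop] fun x => Real.log x ^ (-1 - ε))
    (hB_tail : ∀ x : ℝ, 0 < x → P.real {ω | x < (B 0 ω : ℝ)} = L x / (1 + x))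
    (hb : b = ∫ ω, (B 0 ω : ℝ) ∂P) (hb_pos : 0 < b) (hb_lt : b < 1) :
    -- the series converges
    (∀ x : ℝ, 0 ≤ x →
      Summable fun n : ℕ => clusterTail (P.map A) (P.map (B 0)) (n + 1) x) ∧
    -- the decomposition of the tail of `X`
    ((fun x : ℝ => P.real {ω | x < (X ω : ℝ)}) ~[atTop] fun x =>
      P.real {ω | x < (A ω : ℝ)} +
        ∑' n : ℕ, clusterTail (P.map A) (P.map (B 0)) (n + 1) x) ∧
    -- the asymptotics of each term
    (∀ n : ℕ, 1 ≤ n →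
      (fun x : ℝ => clusterTail (P.map A) (P.map (B 0)) n x) ~[atTop] fun x =>
        (∫ ω in {ω | (A ω : ℝ) ≤ x * b ^ (-(n : ℤ))}, (A ω : ℝ) ∂P) *
            ((n : ℝ) * b ^ (n - 1)) * P.real {ω | x < (B 0 ω : ℝ)} +
          P.real {ω | x * b ^ (-(n : ℤ)) < (A ω : ℝ)}) := by
  have hA_prob : IsProbabilityMeasure (P.map A) :=
    Measure.isProbabilityMeasure_map hA_meas.aemeasurable
  have hX_prob : IsProbabilityMeasure (P.map X) :=
    Measure.isProbabilityMeasure_map hX_meas.aemeasurable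
  have hB_prob : IsProbabilityMeasure (P.map (B 0)) :=
    Measure.isProbabilityMeasure_map (hB_meas 0).aemeasurable
  -- A non-integrable function has integral `0` by convention, which `0 < b` excludes.
  have hint : Integrable (fun ω => (B 0 ω : ℝ)) P := by
    by_contra h
    rw [integral_undef h] at hb
    exact hb_pos.ne' hb
  have hα := tendsto_mul_tailProb_of_isEquivalent hA_meas hA_tail
  have hβ := tendsto_tailProb_mul_log_of_slowlyVarying (hB_meas 0) hL hε hL_equiv hB_tail
  have hS_meas : Measurable fun ω => ∑ i ∈ Finset.range (X ω), B i ω :=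
    measurable_sum_range.comp (hX_meas.prodMk (measurable_pi_lambda _ fun i => hB_meas i))
  have hAS : IndepFun A (fun ω => ∑ i ∈ Finset.range (X ω), B i ω) P :=
    hAXB.comp measurable_id measurable_sum_range
  have hSξ : P.map (fun ω => ∑ i ∈ Finset.range (X ω), B i ω) =
      randomSumLaw (P.map X) (P.map (B 0)) :=
    map_randomSum hX_meas hB_meas hB_indep (fun i => (hB_ident i).map_eq) hXB
  have hsummable : ∀ x : ℝ, 0 ≤ x →
      Summable fun n => tailProb (generationLaw (P.map A) (P.map (B 0)) n) x := fun x hx =>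
    summable_tailProb_generationLaw hB_meas hB_indep hB_ident hint hβ hb hb_pos hb_lt hα hx
  have hcluster := clusterTail_eq_tailProb (P.map A) (P.map (B 0))
  refine ⟨fun x hx => ((summable_nat_add_iff 1).2 (hsummable x hx)).congr fun n =>
    (hcluster _ x).symm, ?_, fun n _ => ?_⟩
  · refine isEquivalent_of_tendsto_id_mul (inv_ne_zero (sub_pos.2 hb_lt).ne')
      ((tendsto_mul_tailProb_fixedPoint hB_meas hB_indep hB_ident hint hβ hb hb_pos hb_lt hA_meas
        hS_meas hAS hα hSξ hfix.map_eq).congr fun x => by rw [tailProb_map hX_meas])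
      ((tendsto_mul_tsum_tailProb_generationLaw hB_meas hB_indep hB_ident hint hβ hb hb_pos
        hb_lt hα).congr' ?_)
    filter_upwards [eventually_ge_atTop 0] with x hx
    -- Generation `0` is `A` itself, so the series over all generations is the tail of `A` plus the
    -- cluster series.
    rw [(hsummable x hx).tsum_eq_zero_add, ← tailProb_map hA_meas,
      tsum_congr fun n => hcluster (n + 1) x, generationLaw]
  · refine isEquivalent_of_tendsto_id_mul (pow_pos hb_pos n).ne'
      ((tendsto_mul_tailProb_generationLaw hB_meas hB_indep hB_ident hint hβ hb hb_pos hb_lt hα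
        n).congr fun x => by rw [hcluster])
      ((tendsto_mul_singleJump hA_meas hα hβ hb_pos n).congr fun x => ?_)
    rw [tailProb_map hA_meas, tailProb_map (hB_meas 0)]
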